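/- There is an absolute constant $C>0$ such that the following holds. Let $\mathcal X$ be a finite non-empty universe, $n\ge 1$, $\varepsilon,\delta\in(0,1)$, $m\in\mathbb N$ and $2^{-m}\le\beta<1$. Then there exist a real number $\alpha>0$ with $$\alpha\le C\left(\frac{\sqrt{\log|\mathcal X|\,\log(1/\delta)}\;\log m}{n\,\varepsilon\,\alpha}+\frac{\log(1/\beta)}{n\,\varepsilon}\right)$$ and a randomized interactive algorithm $\mathcal A$ with the following properties. The algorithm $\mathcal A$ holds a private dataset $S=(x_1,\dots,x_n)\in\mathcal X^n$ and answers $m$ linear queries $f_1,\dots,f_m:\mathcal X\to[0,1]$, chosen one after the other by an arbitrary (randomized) adversary who may base each query on all previous queries and answers; $\tilde f_i\in\mathbb R$ denotes the answer to $f_i$. (1) Privacy: $\mathcal A$ is $(\varepsilon,\delta)$-differentially private, that is, for every adversary, all datasets $S,S'\in\mathcal X^n$ that differ in at most one entry, and every measurable set $E$ of transcripts $(f_i,\tilde f_i)_{i\le m}$, the probability that the transcript lies in $E$ when the dataset is $S$ is at most $e^{\varepsilon}$ times the same probability when the dataset is $S'$, plus $\delta$. (2) Accuracy: for every dataset $S\in\mathcal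 X^n$ and every adversary, with probability at least $1-\beta$, $$\max_{1\le i\le m}\left|\tilde f_i-\frac1n\sum_{j=1}^n f_i(x_j)\right|\le\alpha .$$ -/

import Mathlib

open MeasureTheory ProbabilityTheory

universe u

/-- A linear query over the universe `X`: a function `X → [0,1]`. For finite `X` the space of
queries carries the product σ-algebra. -/
abbrev LinearQuery (X : Type u) : Type u := X → unitInterval

/-- The empirical mean `𝔼_{j ∼ [n]} f (x_j)` of a query `f` on the dataset `S = (x_1, …, x_n)`. -/
noncomputable def empiricalMean {X : Type u} {n : ℕ} (S : Fin n → X) (f : LinearQuery X) : ℝ :=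
  (∑ j, (f (S j) : ℝ)) / n

/-- Two datasets of size `n` are neighboring if they differ in at most one entry. -/
def Neighboring {X : Type u} {n : ℕ} (S S' : Fin n → X) : Prop :=
  ∃ j, ∀ i, i ≠ j → S i = S' i

/-- A transcript of `i` rounds: the queries asked and the answers given, in order. -/
abbrev Transcript (X : Type u) (i : ℕ) : Type u := Fin i → LinearQuery X × ℝ

/-- A randomized interactive (stateful) algorithm that holds a dataset in `X^n` and answers linear
queries. The private input is read when the hidden state is initialized (the state may store it);
then every query is answered by a real number, at random, depending on the hidden state and the
query, and the hidden state is updated. -/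
structure InteractiveMechanism (X : Type u) (n : ℕ) where
  /-- The space of hidden states. -/
  State : Type u
  /-- The σ-algebra on the hidden states. -/
  [measurableState : MeasurableSpace State]
  /-- The law of the initial hidden state on each dataset. -/
  init : (Fin n → X) → Measure State
  [init_prob : ∀ S, IsProbabilityMeasure (init S)]
  /-- The joint law of the answer and the next hidden state, given the current hidden state and
  the query. -/
  answer : Kernel (State × LinearQuery X) (ℝ × State)
  [answer_markov : IsMarkovKernel answer]

attribute [instance] InteractiveMechanism.measurableState InteractiveMechanism.init_prob
  InteractiveMechanism.answer_markov

/-- A (randomized, adaptive) adversary: the law of the next query given the transcript so far. -/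
structure QueryAdversary (X : Type u) where
  /-- The law of the next query, given the transcript of the first `i` rounds. -/
  ask : (i : ℕ) → Kernel (Transcript X i) (LinearQuery X)
  [ask_markov : ∀ i, IsMarkovKernel (ask i)]

attribute [instance] QueryAdversary.ask_markov

namespace InteractiveMechanism

variable {X : Type u} {n : ℕ}

/-- Joint law of the transcript of the first `m` rounds of the interaction of `M`, run on the
dataset `S`, with the adversary `B`, and of the hidden state of `M` after these rounds. -/
noncomputable def run (M : InteractiveMechanism X n) (B : QueryAdversary X) (S : Fin n → X) :
    (m : ℕ) → Measure (Transcript X m × M.State)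
  | 0 => (M.init S).map fun s => (Fin.elim0, s)
  | m + 1 =>
    ((M.run B S m ⊗ₘ (B.ask m).comap (fun p => p.1) measurable_fst) ⊗ₘ
      M.answer.comap (fun p : (Transcript X m × M.State) × LinearQuery X => (p.1.2, p.2))
        (by fun_prop)).map
      fun p : ((Transcript X m × M.State) × LinearQuery X) × (ℝ × M.State) =>
        (Fin.snoc p.1.1.1 (p.1.2, p.2.1), p.2.2)

/-- Law of the transcript of the first `m` rounds. -/
noncomputable def transcriptLaw (M : InteractiveMechanism X n) (B : QueryAdversary X)
    (S : Fin n → X) (m : ℕ) : Measure (Transcript X m) :=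
  (M.run B S m).map Prod.fst

/-- `M` is `(ε, δ)`-differentially private when it answers `m` adaptively chosen queries: against
every adversary, the laws of the transcript on neighboring datasets are
`(ε, δ)`-indistinguishable. -/
def IsDifferentiallyPrivate (M : InteractiveMechanism X n) (m : ℕ) (ε δ : ℝ) : Prop :=
  ∀ (B : QueryAdversary X) (S S' : Fin n → X), Neighboring S S' →
    ∀ E : Set (Transcript X m), MeasurableSet E →
      M.transcriptLaw B S m E ≤
        ENNReal.ofReal (Real.exp ε) * M.transcriptLaw B S' m E + ENNReal.ofReal δ

/-- On every dataset and against every adversary, with probability at least `1 - β` all of the `m`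
answers of `M` are within `α` of the empirical means of the queries. -/
def IsAccurate (M : InteractiveMechanism X n) (m : ℕ) (α β : ℝ) : Prop :=
  ∀ (B : QueryAdversary X) (S : Fin n → X),
    ENNReal.ofReal (1 - β) ≤
      M.transcriptLaw B S m {t | ∀ i, |(t i).2 - empiricalMean S (t i).1| ≤ α}

/-- Extending a transcript by one round is measurable. -/
theorem measurable_snoc_round {σ : Type u} [MeasurableSpace σ] (m : ℕ) :
    Measurable fun p : ((Transcript X m × σ) × LinearQuery X) × (ℝ × σ) =>
      ((Fin.snoc p.1.1.1 (p.1.2, p.2.1) : Transcript X (m + 1)), p.2.2) := by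
  refine Measurable.prodMk (measurable_pi_lambda _ fun i => ?_) (by fun_prop)
  induction i using Fin.lastCases with
  | last => simp only [Fin.snoc_last]; fun_prop
  | cast i => simp only [Fin.snoc_castSucc]; fun_prop

instance isProbabilityMeasure_run (M : InteractiveMechanism X n) (B : QueryAdversary X)
    (S : Fin n → X) (m : ℕ) : IsProbabilityMeasure (M.run B S m) := by
  induction m with
  | zero => exact Measure.isProbabilityMeasure_map (by fun_prop)
  | succ m ih => exact Measure.isProbabilityMeasure_map (measurable_snoc_round m).aemeasurable

instance isProbabilityMeasure_transcriptLaw (M : InteractiveMechanism X n)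
    (B : QueryAdversary X) (S : Fin n → X) (m : ℕ) :
    IsProbabilityMeasure (M.transcriptLaw B S m) :=
  Measure.isProbabilityMeasure_map (by fun_prop)

end InteractiveMechanism

/-!
# Private multiplicative weights for adaptive linear queries

The algorithm is private multiplicative weights with a sparse vector technique that is tuned for
high confidence. It keeps a hypothesis, a probability vector on the universe given by logarithmic
weights. On a query it tests whether the hypothesis underestimates or overestimates the mean of the
query by more than a noisy threshold; as long as a test is positive, the hypothesis is updated in
the indicated direction, and when both tests are negative, it gives the answer. There is a budget
of `T = O(log |X| / α²)` updates. Two choices in the randomness of the tests decouple `β` from the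
number of queries.

* The noise `z ≥ 0` of the threshold is exponential of scale `O(1 / (n ε))` and is drawn once for
  the whole interaction. It accounts for the term `log (1 / β) / (n ε)` of the error.
* Given `z`, a test at distance `x` below the threshold, in units of `v = O(s / (n ε))` with `s =
  min (T, √(T log (1/δ)))`, is positive with probability `y (2 - y)`, where `y = min 1 (exp (-x))`
  (`testProb`). Above the threshold it is always positive. Thus an answer is off by more than the
  threshold only if the updates have run out.

*Privacy.* When passing to a neighboring dataset, the threshold is moved up by the sensitivity, so
that every negative outcome becomes more likely. Then negative outcomes cost nothing in the pure
accounting, and a positive outcome costs `O(ε / s)`. In the quadratic accounting, the power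
divergence of the outcome of a test exceeds `1` only by the order of the square of the step times
the probability of a positive outcome, because the probability `(1 - y)²` of a negative outcome
vanishes to second order at the threshold (`divergence_le_one_of_quadratic_charge`). Hence only
positive outcomes are charged, and there are at most `T` of them. The divergences are composed in a
dual form: the likelihood ratio has `L^a` norm at most `R` if and only if `∫ φ dP ≤ R (∫ φ^b
dQ)^(1/b)` for all `φ ≥ 0`, where `b` is the conjugate exponent, and this inequality passes through
an adaptive interaction by Jensen's inequality (`InteractiveMechanism.value_translate_le`). The
pure and the quadratic accounting together (`exists_charge`) cover all values of `log (1 / δ)`.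

*Accuracy.* An update that is due decreases the potential `log ∑ exp w - ⟨c, w⟩`; an update at a
distance `d` below the threshold may increase it by an amount proportional to `d`, but has
probability `O(exp (-d / v))`. So an exponential of the potential and of the number of remaining
updates is a supermartingale up to a factor `1 + q` for each test, with `q ≤ 1 / (2 m)`
(`lintegral_pmwRound_le`). The probability that the updates run out is therefore exponentially
small in `T α / v`, and `s ≤ T` makes this at most `β / 2` at no further cost.

*Large `δ`.* As `δ` tends to `1`, the first term of the bound tends to `0`. There only a random
block of about `2 (1 - δ) n` entries is private, and the others are revealed: an entry is protected
with the probability that the block contains it, which suffices for `δ` (`sum_rotatedBlock_le`),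
and an error in the block counts only in proportion to its size. If `β ≥ 2 (1 - δ)`, the whole
dataset may even be revealed with probability `1 - 2 (1 - δ)`. A single query, for which `log m =
0`, is answered with Laplace noise.
-/

open scoped ENNReal

/-! ### Expectations over the interaction -/

namespace InteractiveMechanism

variable {X : Type u} {n : ℕ}

/-- The expectation of `φ` after one more round of the interaction, as a function of the transcript
and the hidden state before this round. -/
noncomputable def roundExpectation (M : InteractiveMechanism X n) (B : QueryAdversary X) (m : ℕ)
    (φ : Transcript X (m + 1) × M.State → ℝ≥0∞) (p : Transcript X m × M.State) : ℝ≥0∞ :=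
  ∫⁻ f, ∫⁻ a, φ (Fin.snoc p.1 (f, a.1), a.2) ∂(M.answer (p.2, f)) ∂(B.ask m p.1)

/-- The expectation of `φ` after `m` rounds of the interaction that start in the hidden
state `s`. -/
noncomputable def value (M : InteractiveMechanism X n) (B : QueryAdversary X) :
    (m : ℕ) → (Transcript X m × M.State → ℝ≥0∞) → M.State → ℝ≥0∞
  | 0, φ, s => φ (Fin.elim0, s)
  | m + 1, φ, s => M.value B m (M.roundExpectation B m φ) s

variable (M : InteractiveMechanism X n) (B : QueryAdversary X)

theorem measurable_answer_integral {m : ℕ} {φ : Transcript X (m + 1) × M.State → ℝ≥0∞}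
    (hφ : Measurable φ) :
    Measurable fun p : (Transcript X m × M.State) × LinearQuery X =>
      ∫⁻ a, φ (Fin.snoc p.1.1 (p.2, a.1), a.2) ∂(M.answer (p.1.2, p.2)) := by
  have h := (hφ.comp (measurable_snoc_round (σ := M.State) m)).lintegral_kernel_prod_right'
    (κ := M.answer.comap
      (fun p : (Transcript X m × M.State) × LinearQuery X => (p.1.2, p.2)) (by fun_prop))
  exact h

theorem measurable_roundExpectation {m : ℕ} {φ : Transcript X (m + 1) × M.State → ℝ≥0∞}
    (hφ : Measurable φ) : Measurable (M.roundExpectation B m φ) :=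
  (M.measurable_answer_integral hφ).lintegral_kernel_prod_right'
    (κ := (B.ask m).comap (fun p : Transcript X m × M.State => p.1) measurable_fst)

theorem lintegral_run_succ (S : Fin n → X) {m : ℕ}
    {φ : Transcript X (m + 1) × M.State → ℝ≥0∞} (hφ : Measurable φ) :
    ∫⁻ p, φ p ∂(M.run B S (m + 1)) = ∫⁻ p, M.roundExpectation B m φ p ∂(M.run B S m) := by
  have h1 : Measurable fun p : ((Transcript X m × M.State) × LinearQuery X) × (ℝ × M.State) =>
      φ (Fin.snoc p.1.1.1 (p.1.2, p.2.1), p.2.2) :=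
    hφ.comp (measurable_snoc_round (σ := M.State) m)
  rw [run, lintegral_map hφ (measurable_snoc_round m), Measure.lintegral_compProd h1,
    Measure.lintegral_compProd]
  · rfl
  · exact M.measurable_answer_integral hφ

theorem measurable_value {m : ℕ} {φ : Transcript X m × M.State → ℝ≥0∞} (hφ : Measurable φ) :
    Measurable (M.value B m φ) := by
  induction m with
  | zero => exact hφ.comp (by fun_prop)
  | succ m ih => exact ih (M.measurable_roundExpectation B hφ)

/-- The law of the interaction is a mixture over the initial hidden state. -/
theorem lintegral_run (S : Fin n → X) {m : ℕ} {φ : Transcript X m × M.State → ℝ≥0∞}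
    (hφ : Measurable φ) :
    ∫⁻ p, φ p ∂(M.run B S m) = ∫⁻ s, M.value B m φ s ∂(M.init S) := by
  induction m with
  | zero => rw [run, lintegral_map hφ (by fun_prop)]; rfl
  | succ m ih =>
    rw [M.lintegral_run_succ B S hφ, ih (M.measurable_roundExpectation B hφ)]; rfl

theorem roundExpectation_mono {m : ℕ} {φ ψ : Transcript X (m + 1) × M.State → ℝ≥0∞}
    (h : ∀ p, φ p ≤ ψ p) (p : Transcript X m × M.State) :
    M.roundExpectation B m φ p ≤ M.roundExpectation B m ψ p :=
  lintegral_mono fun _ => lintegral_mono fun _ => h _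

theorem value_mono {m : ℕ} {φ ψ : Transcript X m × M.State → ℝ≥0∞} (h : ∀ p, φ p ≤ ψ p)
    (s : M.State) : M.value B m φ s ≤ M.value B m ψ s := by
  induction m with
  | zero => exact h _
  | succ m ih => exact ih (M.roundExpectation_mono B h)

theorem value_one (m : ℕ) (s : M.State) : M.value B m (fun _ => 1) s = 1 := by
  induction m with
  | zero => rfl
  | succ m ih =>
    have : M.roundExpectation B m (fun _ => 1) = fun _ => 1 := by
      funext p; simp [roundExpectation]
    rw [value, this, ih]

/-- A function of the round, the transcript and the hidden state whose expectation does not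
increase in any round bounds its expectation at the end by its value at the start. -/
theorem value_le_of_supermartingale {m : ℕ}
    (G : (i : ℕ) → Transcript X i × M.State → ℝ≥0∞)
    (hG : ∀ i < m, ∀ p, M.roundExpectation B i (G (i + 1)) p ≤ G i p) (s : M.State) :
    M.value B m (G m) s ≤ G 0 (Fin.elim0, s) := by
  induction m with
  | zero => exact le_rfl
  | succ m ih =>
    exact (M.value_mono B (hG m m.lt_succ_self) s).trans
      (ih fun i hi p => hG i (hi.trans m.lt_succ_self) p)

/-- Jensen's inequality for the concave power `1 / b`. -/
theorem lintegral_rpow_inv_le {α : Type*} [MeasurableSpace α] (μ : Measure α)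
    [IsProbabilityMeasure μ] {b : ℝ} (hb : 1 < b) {g : α → ℝ≥0∞} (hg : Measurable g) :
    ∫⁻ x, g x ^ (1 / b) ∂μ ≤ (∫⁻ x, g x ∂μ) ^ (1 / b) := by
  have h := ENNReal.lintegral_mul_le_Lp_mul_Lq μ (Real.HolderConjugate.conjExponent hb)
    (f := fun x => g x ^ (1 / b)) (g := fun _ => 1) (by fun_prop) (by fun_prop)
  have hb0 : b ≠ 0 := by positivity
  simpa [← ENNReal.rpow_mul, hb0] using h

/-- Composition of the privacy of the single rounds. If `σ` translates the hidden states of the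
interaction on one dataset into hidden states of the interaction on another, then a bound on the
`L^a` norm of the likelihood ratio of the rounds, in its dual form with the conjugate exponent `b`,
yields one for the whole interaction. The weight `ℓ` keeps track of the part of the privacy budget
that is not spent. -/
theorem value_translate_le {b : ℝ} (hb : 1 < b) (σ : M.State → M.State)
    (ℓ : M.State → ℝ≥0∞)
    (hround : ∀ (s : M.State) (f : LinearQuery X) (φ : ℝ × M.State → ℝ≥0∞), Measurable φ →
      ∫⁻ a, φ (a.1, σ a.2) * ℓ a.2 ∂(M.answer (s, f)) ≤
        ℓ s * (∫⁻ a, φ a ^ b ∂(M.answer (σ s, f))) ^ (1 / b))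
    {m : ℕ} {φ : Transcript X m × M.State → ℝ≥0∞} (hφ : Measurable φ) (s : M.State) :
    M.value B m (fun p => φ (p.1, σ p.2) * ℓ p.2) s ≤
      ℓ s * (M.value B m (fun p => φ p ^ b) (σ s)) ^ (1 / b) := by
  have hb0 : b ≠ 0 := by positivity
  induction m with
  | zero => simp [value, ← ENNReal.rpow_mul, hb0, mul_comm]
  | succ m ih =>
    set ψ : Transcript X m × M.State → ℝ≥0∞ :=
      fun p => (M.roundExpectation B m (fun p => φ p ^ b) p) ^ (1 / b) with hψ
    have hψm : Measurable ψ :=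
      (M.measurable_roundExpectation B (hφ.pow_const b)).pow_const _
    have key : ∀ p, M.roundExpectation B m (fun p => φ (p.1, σ p.2) * ℓ p.2) p ≤
        ψ (p.1, σ p.2) * ℓ p.2 := by
      rintro ⟨t, s⟩
      have hm : Measurable fun f : LinearQuery X =>
          ∫⁻ a, φ (Fin.snoc t (f, a.1), a.2) ^ b ∂(M.answer (σ s, f)) :=
        (M.measurable_answer_integral (hφ.pow_const b)).comp
          (g := fun p => _) (f := fun f : LinearQuery X => ((t, σ s), f)) (by fun_prop)
      calc M.roundExpectation B m (fun p => φ (p.1, σ p.2) * ℓ p.2) (t, s)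
          ≤ ∫⁻ f, ℓ s * (∫⁻ a, φ (Fin.snoc t (f, a.1), a.2) ^ b ∂(M.answer (σ s, f))) ^ (1 / b)
              ∂(B.ask m t) := by
            refine lintegral_mono fun f => ?_
            refine hround s f (fun a => φ (Fin.snoc t (f, a.1), a.2)) ?_
            exact (hφ.comp (measurable_snoc_round (σ := M.State) m)).comp
              (f := fun a : ℝ × M.State => (((t, a.2), f), a)) (by fun_prop)
        _ = ℓ s * ∫⁻ f, (∫⁻ a, φ (Fin.snoc t (f, a.1), a.2) ^ b ∂(M.answer (σ s, f))) ^ (1 / b)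
              ∂(B.ask m t) := lintegral_const_mul _ (hm.pow_const _)
        _ ≤ ℓ s * (∫⁻ f, ∫⁻ a, φ (Fin.snoc t (f, a.1), a.2) ^ b ∂(M.answer (σ s, f))
              ∂(B.ask m t)) ^ (1 / b) := by
            gcongr; exact lintegral_rpow_inv_le _ hb hm
        _ = ψ (t, σ s) * ℓ s := by rw [mul_comm]; rfl
    refine (M.value_mono B key s).trans ((ih hψm).trans (le_of_eq ?_))
    simp [hψ, value, ← ENNReal.rpow_mul, hb0]

end InteractiveMechanism

/-! ### Private multiplicative weights -/

/-- The linear form `a ↦ ∑ x, a x * f x` given by a query; for a probability vector `a`, the mean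
of the query. -/
noncomputable def queryMean {X : Type u} [Fintype X] (a : X → ℝ) (f : LinearQuery X) : ℝ :=
  ∑ x, a x * (f x : ℝ)

/-- The probability vector with logarithmic weights `w`. -/
noncomputable def softmax {X : Type u} [Fintype X] (w : X → ℝ) (x : X) : ℝ :=
  Real.exp (w x) / ∑ y, Real.exp (w y)

/-- The ratio `min 1 (exp v)` that governs the threshold test. -/
noncomputable def testRatio (v : ℝ) : ℝ := min 1 (Real.exp v)

/-- The probability that the threshold test is positive on a value that exceeds the threshold by
`v` (in units of the noise). It is `1` above the threshold and decays exponentially below it.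
Its complement `(1 - y)²` vanishes to second order at the threshold, so that a shift of `v` by `k`
changes the law of the outcome by only `O(k² · probability of a positive outcome)` in relative
entropy. -/
noncomputable def testProb (v : ℝ) : ℝ := testRatio v * (2 - testRatio v)

/-- A hidden state of private multiplicative weights: the public part of the dataset (as a vector,
with the total mass of the private part), the normalized histogram of the private part, the noise
of the threshold, the number of updates that are left, and the logarithmic weights of the current
hypothesis. -/
abbrev PMWState (X : Type u) : Type u := ((X → ℝ) × ℝ) × (X → ℝ) × ℝ × ℕ × (X → ℝ)

section loop

variable {X : Type u}

/-- The multiplicative weights update of the logarithmic weights `w` in direction `f`. -/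
def mwUpdate (η : ℝ) (w : X → ℝ) (f : LinearQuery X) : X → ℝ := fun x => w x + η * (f x : ℝ)

@[fun_prop]
theorem measurable_mwUpdate (η : ℝ) :
    Measurable fun p : (X → ℝ) × LinearQuery X => mwUpdate η p.1 p.2 := by
  unfold mwUpdate; fun_prop

variable [Fintype X]

/-- The answer to `f`: exact on the public part of the dataset, and according to the hypothesis
on the private part. -/
noncomputable def pmwAnswer (o : (X → ℝ) × ℝ) (w : X → ℝ) (f : LinearQuery X) : ℝ :=
  queryMean o.1 f + o.2 * queryMean (softmax w) f

/-- The exponent of the test whether the hypothesis `w` underestimates the mean of `f` on `c`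
by more than the threshold `τ + z` (overestimates, for the negative `sgn`). -/
noncomputable def testExponent (κ τ sgn : ℝ) (c : X → ℝ) (z : ℝ) (w : X → ℝ)
    (f : LinearQuery X) : ℝ :=
  κ * (sgn * (queryMean c f - queryMean (softmax w) f) - τ - z)

/-- One round of private multiplicative weights, by recursion on the number of updates that are
left: the hypothesis is tested for an underestimate and for an overestimate of the mean of the
query; if a test is positive, it is updated and tested anew, and otherwise it is used for the
answer. -/
noncomputable def pmwRound (κ τ : ℝ) (o : (X → ℝ) × ℝ) (c : X → ℝ) (z : ℝ) (f : LinearQuery X) :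
    ℕ → (X → ℝ) → Measure (ℝ × PMWState X)
  | 0, w => Measure.dirac (pmwAnswer o w f, (o, c, z, 0, w))
  | r + 1, w =>
    ENNReal.ofReal (testProb (testExponent κ τ 1 c z w f)) •
        pmwRound κ τ o c z f r (mwUpdate (τ / 2) w f) +
      ENNReal.ofReal (1 - testProb (testExponent κ τ 1 c z w f)) •
        (ENNReal.ofReal (testProb (testExponent κ τ (-1) c z w f)) •
            pmwRound κ τ o c z f r (mwUpdate (-(τ / 2)) w f) +
          ENNReal.ofReal (1 - testProb (testExponent κ τ (-1) c z w f)) •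
            Measure.dirac (pmwAnswer o w f, (o, c, z, r + 1, w)))

theorem testRatio_pos (v : ℝ) : 0 < testRatio v := lt_min one_pos (Real.exp_pos v)

theorem testRatio_le_one (v : ℝ) : testRatio v ≤ 1 := min_le_left _ _

theorem testProb_pos (v : ℝ) : 0 < testProb v :=
  mul_pos (testRatio_pos v) (by linarith [testRatio_le_one v])

theorem one_sub_testProb (v : ℝ) : 1 - testProb v = (1 - testRatio v) ^ 2 := by
  unfold testProb; ring

theorem testProb_le_one (v : ℝ) : testProb v ≤ 1 := by
  have := one_sub_testProb v
  nlinarith [sq_nonneg (1 - testRatio v)]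

theorem testProb_of_nonneg {v : ℝ} (hv : 0 ≤ v) : testProb v = 1 := by
  have : testRatio v = 1 := min_eq_left (Real.one_le_exp hv)
  rw [testProb, this]; norm_num

theorem testProb_le_exp (v : ℝ) : testProb v ≤ 2 * Real.exp v := by
  have h1 : testRatio v ≤ Real.exp v := min_le_right _ _
  have h2 := testRatio_pos v
  unfold testProb; nlinarith

theorem ofReal_add_ofReal_one_sub {p : ℝ} (h0 : 0 ≤ p) (h1 : p ≤ 1) :
    ENNReal.ofReal p + ENNReal.ofReal (1 - p) = 1 := by
  rw [← ENNReal.ofReal_add h0 (by linarith)]; simp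

theorem isProbabilityMeasure_mix {α : Type*} [MeasurableSpace α] (μ ν : Measure α)
    [IsProbabilityMeasure μ] [IsProbabilityMeasure ν] {p : ℝ} (h0 : 0 ≤ p) (h1 : p ≤ 1) :
    IsProbabilityMeasure (ENNReal.ofReal p • μ + ENNReal.ofReal (1 - p) • ν) :=
  ⟨by simp [ofReal_add_ofReal_one_sub h0 h1]⟩

instance isProbabilityMeasure_pmwRound (κ τ : ℝ) (o : (X → ℝ) × ℝ) (c : X → ℝ) (z : ℝ)
    (f : LinearQuery X) (r : ℕ) (w : X → ℝ) :
    IsProbabilityMeasure (pmwRound κ τ o c z f r w) := by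
  induction r generalizing w with
  | zero => rw [pmwRound]; infer_instance
  | succ r ih =>
    rw [pmwRound]
    have := isProbabilityMeasure_mix (pmwRound κ τ o c z f r (mwUpdate (-(τ / 2)) w f))
      (Measure.dirac (pmwAnswer o w f, (o, c, z, r + 1, w)))
      (testProb_pos (testExponent κ τ (-1) c z w f)).le (testProb_le_one _)
    exact isProbabilityMeasure_mix _ _ (testProb_pos _).le (testProb_le_one _)

theorem lintegral_pmwRound_succ (κ τ : ℝ) (o : (X → ℝ) × ℝ) (c : X → ℝ) (z : ℝ)
    (f : LinearQuery X) (r : ℕ) (w : X → ℝ) {φ : ℝ × PMWState X → ℝ≥0∞} (hφ : Measurable φ) :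
    ∫⁻ a, φ a ∂(pmwRound κ τ o c z f (r + 1) w) =
      ENNReal.ofReal (testProb (testExponent κ τ 1 c z w f)) *
          ∫⁻ a, φ a ∂(pmwRound κ τ o c z f r (mwUpdate (τ / 2) w f)) +
        ENNReal.ofReal (1 - testProb (testExponent κ τ 1 c z w f)) *
          (ENNReal.ofReal (testProb (testExponent κ τ (-1) c z w f)) *
              ∫⁻ a, φ a ∂(pmwRound κ τ o c z f r (mwUpdate (-(τ / 2)) w f)) +
            ENNReal.ofReal (1 - testProb (testExponent κ τ (-1) c z w f)) *
              φ (pmwAnswer o w f, (o, c, z, r + 1, w))) := by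
  rw [pmwRound, lintegral_add_measure, lintegral_smul_measure, lintegral_smul_measure,
    lintegral_add_measure, lintegral_smul_measure, lintegral_smul_measure, lintegral_dirac' _ hφ]
  rfl

@[fun_prop]
theorem measurable_testProb : Measurable testProb := by
  unfold testProb testRatio; fun_prop

@[fun_prop]
theorem measurable_queryMean :
    Measurable fun p : (X → ℝ) × LinearQuery X => queryMean p.1 p.2 := by
  unfold queryMean; fun_prop

@[fun_prop]
theorem measurable_softmax : Measurable (softmax : (X → ℝ) → X → ℝ) := by
  unfold softmax; fun_prop

@[fun_prop]
theorem measurable_pmwAnswer :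
    Measurable fun p : ((X → ℝ) × ℝ) × (X → ℝ) × LinearQuery X =>
      pmwAnswer p.1 p.2.1 p.2.2 := by
  have h1 : Measurable fun p : ((X → ℝ) × ℝ) × (X → ℝ) × LinearQuery X =>
    queryMean p.1.1 p.2.2 := measurable_queryMean.comp (by fun_prop :
      Measurable fun p : ((X → ℝ) × ℝ) × (X → ℝ) × LinearQuery X => (p.1.1, p.2.2))
  have h2 : Measurable fun p : ((X → ℝ) × ℝ) × (X → ℝ) × LinearQuery X =>
    queryMean (softmax p.2.1) p.2.2 := measurable_queryMean.comp (by fun_prop :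
      Measurable fun p : ((X → ℝ) × ℝ) × (X → ℝ) × LinearQuery X => (softmax p.2.1, p.2.2))
  unfold pmwAnswer; fun_prop

theorem measurable_testExponent (κ τ sgn : ℝ) :
    Measurable fun p : (X → ℝ) × ℝ × (X → ℝ) × LinearQuery X =>
      testExponent κ τ sgn p.1 p.2.1 p.2.2.1 p.2.2.2 := by
  have h1 : Measurable fun p : (X → ℝ) × ℝ × (X → ℝ) × LinearQuery X =>
    queryMean p.1 p.2.2.2 := measurable_queryMean.comp (by fun_prop :
      Measurable fun p : (X → ℝ) × ℝ × (X → ℝ) × LinearQuery X => (p.1, p.2.2.2))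
  have h2 : Measurable fun p : (X → ℝ) × ℝ × (X → ℝ) × LinearQuery X =>
    queryMean (softmax p.2.2.1) p.2.2.2 := measurable_queryMean.comp (by fun_prop :
      Measurable fun p : (X → ℝ) × ℝ × (X → ℝ) × LinearQuery X => (softmax p.2.2.1, p.2.2.2))
  unfold testExponent; fun_prop

theorem measurable_pmwRound (κ τ : ℝ) (r : ℕ) :
    Measurable fun p : ((X → ℝ) × ℝ) × (X → ℝ) × ℝ × (X → ℝ) × LinearQuery X =>
      pmwRound κ τ p.1 p.2.1 p.2.2.1 p.2.2.2.2 r p.2.2.2.1 := by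
  have hans : ∀ r : ℕ, Measurable
      fun p : ((X → ℝ) × ℝ) × (X → ℝ) × ℝ × (X → ℝ) × LinearQuery X =>
        Measure.dirac ((pmwAnswer p.1 p.2.2.2.1 p.2.2.2.2,
          (p.1, p.2.1, p.2.2.1, r, p.2.2.2.1)) : ℝ × PMWState X) := fun r =>
    Measure.measurable_dirac.comp (Measurable.prodMk (measurable_pmwAnswer.comp
      (by fun_prop : Measurable fun p : ((X → ℝ) × ℝ) × (X → ℝ) × ℝ × (X → ℝ) × LinearQuery X =>
        (p.1, p.2.2.2.1, p.2.2.2.2))) (by fun_prop))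
  induction r with
  | zero => simpa only [pmwRound] using hans 0
  | succ r ih =>
    have hp : ∀ sgn, Measurable
        fun p : ((X → ℝ) × ℝ) × (X → ℝ) × ℝ × (X → ℝ) × LinearQuery X =>
          testProb (testExponent κ τ sgn p.2.1 p.2.2.1 p.2.2.2.1 p.2.2.2.2) := fun sgn =>
      measurable_testProb.comp ((measurable_testExponent κ τ sgn).comp measurable_snd)
    have hu : ∀ η, Measurable
        fun p : ((X → ℝ) × ℝ) × (X → ℝ) × ℝ × (X → ℝ) × LinearQuery X =>
          (p.1, p.2.1, p.2.2.1, mwUpdate η p.2.2.2.1 p.2.2.2.2, p.2.2.2.2) := fun η => by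
      have := (measurable_mwUpdate (X := X) η).comp (by fun_prop :
        Measurable fun p : ((X → ℝ) × ℝ) × (X → ℝ) × ℝ × (X → ℝ) × LinearQuery X =>
          (p.2.2.2.1, p.2.2.2.2))
      exact Measurable.prodMk (by fun_prop) (Measurable.prodMk (by fun_prop)
        (Measurable.prodMk (by fun_prop) (Measurable.prodMk this (by fun_prop))))
    refine Measure.measurable_of_measurable_coe _ fun A hA => ?_
    have hmeas : ∀ η, Measurable
        fun p : ((X → ℝ) × ℝ) × (X → ℝ) × ℝ × (X → ℝ) × LinearQuery X =>
          pmwRound κ τ p.1 p.2.1 p.2.2.1 p.2.2.2.2 r (mwUpdate η p.2.2.2.1 p.2.2.2.2) A :=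
      fun η => (Measure.measurable_coe hA).comp (ih.comp (hu η))
    have hd := (Measure.measurable_coe hA).comp (hans (r + 1))
    have h1 := hp 1
    have h2 := hp (-1)
    simp only [pmwRound, Measure.add_apply, Measure.smul_apply, smul_eq_mul]
    exact (h1.ennreal_ofReal.mul (hmeas _)).add ((h1.const_sub 1).ennreal_ofReal.mul
      ((h2.ennreal_ofReal.mul (hmeas _)).add ((h2.const_sub 1).ennreal_ofReal.mul hd)))

/-- The kernel of one round of private multiplicative weights. -/
noncomputable def pmwKernel (κ τ : ℝ) :
    Kernel (PMWState X × LinearQuery X) (ℝ × PMWState X) where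
  toFun p := pmwRound κ τ p.1.1 p.1.2.1 p.1.2.2.1 p.2 p.1.2.2.2.1 p.1.2.2.2.2
  measurable' := by
    have h : Measurable fun q : ℕ × (((X → ℝ) × ℝ) × (X → ℝ) × ℝ × (X → ℝ) × LinearQuery X) =>
        pmwRound κ τ q.2.1 q.2.2.1 q.2.2.2.1 q.2.2.2.2.2 q.1 q.2.2.2.2.1 :=
      measurable_from_prod_countable_right fun r => measurable_pmwRound κ τ r
    exact h.comp (by fun_prop : Measurable fun p : PMWState X × LinearQuery X =>
      (p.1.2.2.2.1, (p.1.1, p.1.2.1, p.1.2.2.1, p.1.2.2.2.2, p.2)))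

instance (κ τ : ℝ) : IsMarkovKernel (pmwKernel (X := X) κ τ) :=
  ⟨fun p => isProbabilityMeasure_pmwRound κ τ p.1.1 p.1.2.1 p.1.2.2.1 p.2 p.1.2.2.2.1 p.1.2.2.2.2⟩

end loop

section mechanism

variable {X : Type u} {n : ℕ}

/-- The contribution `∑ j ∈ Q, 1_{S j}` of the entries in `Q` to the histogram of `S`. -/
noncomputable def blockHistogram (Q : Finset (Fin n)) (S : Fin n → X) (x : X) : ℝ := by
  classical exact ∑ j ∈ Q, if S j = x then 1 else 0

/-- The initial hidden state when the entries in `Q` are private and the others public. -/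
noncomputable def pmwStart (T : ℕ) (Q : Finset (Fin n)) (S : Fin n → X) (z : ℝ) : PMWState X :=
  ((fun x => blockHistogram Qᶜ S x / n, (Q.card : ℝ) / n),
    fun x => blockHistogram Q S x / Q.card, z, T, 0)

theorem measurable_pmwStart (T : ℕ) (Q : Finset (Fin n)) (S : Fin n → X) :
    Measurable (pmwStart T Q S) := by
  unfold pmwStart; fun_prop

variable [Fintype X]

/-- Private multiplicative weights on a random part of the dataset: with probability `q i` the
entries in `Q i` are private and the others public. The noise of the threshold has the exponential
law of rate `θ` and is drawn only once, at most `T` updates are made. -/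
noncomputable abbrev pmwMechanism (κ τ : ℝ) (T : ℕ) {θ : ℝ} (hθ : 0 < θ) {ι : Type} [Fintype ι]
    (Q : ι → Finset (Fin n)) (q : ι → ℝ≥0∞) (hq : ∑ i, q i = 1) : InteractiveMechanism X n where
  State := PMWState X
  init S := ∑ i, q i • (expMeasure θ).map (pmwStart T (Q i) S)
  init_prob S := by
    have := isProbabilityMeasure_expMeasure hθ
    have h : ∀ i, IsProbabilityMeasure ((expMeasure θ).map (pmwStart T (Q i) S)) := fun i =>
      Measure.isProbabilityMeasure_map (measurable_pmwStart T (Q i) S).aemeasurable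
    exact ⟨by simp [Measure.finsetSum_apply, hq]⟩
  answer := pmwKernel κ τ

end mechanism

/-! ### The threshold test under a shift of the threshold -/

theorem exp_neg_le_quadratic {x : ℝ} (hx : 0 ≤ x) : Real.exp (-x) ≤ 1 - x + x ^ 2 := by
  rcases le_total x 1 with h | h
  · have := abs_le.1 (Real.abs_exp_sub_one_sub_id_le (x := -x) (by rwa [abs_neg, abs_of_nonneg hx]))
    linarith [this.2, neg_sq x]
  · have : Real.exp (-x) ≤ 1 := Real.exp_le_one_iff.2 (by linarith)
    nlinarith

theorem mul_div_rpow_le_exp {x x' l : ℝ} (hx : 0 ≤ x) (hx' : 0 < x') (hl : 0 ≤ l) :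
    x * (x / x') ^ l ≤ x' * Real.exp ((1 + l) * ((x - x') / x')) := by
  have h1 : x / x' ≤ Real.exp ((x - x') / x') := by
    have := Real.add_one_le_exp ((x - x') / x')
    rwa [sub_div, div_self hx'.ne', sub_add_cancel, ← div_self hx'.ne', ← sub_div] at this
  have h2 : (x / x') ^ l ≤ Real.exp (((x - x') / x') * l) := by
    rw [Real.exp_mul]; exact Real.rpow_le_rpow (by positivity) h1 hl
  have h3 : x ≤ x' * Real.exp ((x - x') / x') := by
    rwa [div_le_iff₀' hx'] at h1
  calc x * (x / x') ^ l ≤ (x' * Real.exp ((x - x') / x')) * Real.exp (((x - x') / x') * l) := by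
        gcongr
    _ = _ := by rw [mul_assoc, ← Real.exp_add]; ring_nf

section testProb

variable {v v' k l : ℝ}

theorem testRatio_mono (h : v' ≤ v) : testRatio v' ≤ testRatio v :=
  min_le_min_left _ (Real.exp_le_exp.2 h)

theorem testRatio_le_exp_mul (hk : 0 ≤ k) (h : v ≤ v' + k) :
    testRatio v ≤ Real.exp k * testRatio v' := by
  unfold testRatio
  rw [mul_min_of_nonneg _ _ (Real.exp_pos k).le, mul_one, ← Real.exp_add]
  exact min_le_min (Real.one_le_exp hk) (Real.exp_le_exp.2 (by linarith))

theorem testProb_mono (h : v' ≤ v) : testProb v' ≤ testProb v := by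
  have h1 := testRatio_mono h
  have h2 := testRatio_le_one v
  unfold testProb; nlinarith

theorem testProb_le_exp_mul (hk : 0 ≤ k) (hv : v' ≤ v) (h : v ≤ v' + k) :
    testProb v ≤ Real.exp k * testProb v' := by
  have h1 := testRatio_mono hv
  have h2 := testRatio_le_one v
  have h3 := testRatio_le_exp_mul hk h
  have h4 := testRatio_pos v
  have h5 := Real.exp_pos k
  unfold testProb
  calc testRatio v * (2 - testRatio v)
      ≤ (Real.exp k * testRatio v') * (2 - testRatio v') := by
        have h6 := testRatio_pos v'
        have h7 : 0 ≤ 2 - testRatio v := by linarith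
        gcongr
    _ = _ := by ring

/-- Negative outcomes of the test contribute at most their own probability, if the threshold is
shifted upwards. -/
theorem neg_term_le (hl : 0 ≤ l) (hv : v' ≤ v) :
    (1 - testProb v) * ((1 - testProb v) / (1 - testProb v')) ^ l ≤ 1 - testProb v := by
  have h1 := testProb_mono hv
  have h2 := testProb_le_one v
  refine mul_le_of_le_one_right (by linarith) (Real.rpow_le_one ?_ ?_ hl)
  · exact div_nonneg (by linarith) (by linarith)
  · exact div_le_one_of_le₀ (by linarith) (by linarith)

/-- The contribution of a positive outcome, when it is charged the maximal loss `k * l`. -/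
theorem pos_term_le (hl : 0 ≤ l) (hk : 0 ≤ k) (hv : v' ≤ v) (h : v ≤ v' + k) :
    testProb v * (testProb v / testProb v') ^ l * Real.exp (-(k * l)) ≤ testProb v := by
  have h1 : testProb v / testProb v' ≤ Real.exp k :=
    (div_le_iff₀ (testProb_pos v')).2 (testProb_le_exp_mul hk hv h)
  have h2 : (testProb v / testProb v') ^ l ≤ Real.exp (k * l) := by
    rw [Real.exp_mul]
    exact Real.rpow_le_rpow (div_nonneg (testProb_pos v).le (testProb_pos v').le) h1 hl
  calc testProb v * (testProb v / testProb v') ^ l * Real.exp (-(k * l))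
      ≤ testProb v * Real.exp (k * l) * Real.exp (-(k * l)) := by
        gcongr; exact (testProb_pos v).le
    _ = testProb v := by rw [mul_assoc, ← Real.exp_add]; simp

/-- The power divergence of the outcome of a test under a shift of the threshold, when a positive
outcome is charged `k * l`: pure privacy. -/
theorem divergence_le_one_of_linear_charge (hl : 0 ≤ l) (hk : 0 ≤ k) (hv : v' ≤ v)
    (h : v ≤ v' + k) :
    testProb v * (testProb v / testProb v') ^ l * Real.exp (-(k * l)) +
      (1 - testProb v) * ((1 - testProb v) / (1 - testProb v')) ^ l ≤ 1 := by
  linarith [neg_term_le hl hv, pos_term_le hl hk hv h]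

theorem exp_le_one_add_two_mul (hk : 0 ≤ k) (hk1 : k ≤ 1 / 16) : Real.exp k ≤ 1 + 2 * k := by
  have := abs_le.1 (Real.abs_exp_sub_one_sub_id_le (x := k)
    (by rw [abs_of_nonneg hk]; linarith))
  nlinarith [this.2]

theorem exp_neg_le_one_sub_half {x : ℝ} (hx : 0 ≤ x) (hx1 : x ≤ 1) :
    Real.exp (-x) ≤ 1 - x / 2 := by
  have h4 := Real.add_one_le_exp x
  rw [Real.exp_neg]
  refine (inv_anti₀ (by linarith) h4).trans ?_
  rw [inv_le_iff_one_le_mul₀ (by linarith)]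
  nlinarith

/-- The first-order shift of the probability, relative to a positive outcome. -/
theorem sub_div_testProb_le (hk : 0 ≤ k) (hk1 : k ≤ 1 / 16) (hv : v' ≤ v) (h : v ≤ v' + k) :
    (testProb v - testProb v') / testProb v' ≤ 2 * k := by
  have hp0 := testProb_pos v'
  rw [div_le_iff₀ hp0]
  calc testProb v - testProb v' ≤ Real.exp k * testProb v' - testProb v' := by
        gcongr; exact testProb_le_exp_mul hk hv h
    _ ≤ (1 + 2 * k) * testProb v' - testProb v' := by
        gcongr; exact exp_le_one_add_two_mul hk hk1
    _ = _ := by ring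

/-- The squared shift of the probability, relative to a negative outcome, is of the order of the
probability of a positive outcome: this is where the quadratic decay of the probability of a
negative outcome at the threshold is needed. -/
theorem sq_sub_div_one_sub_testProb_le (hk : 0 ≤ k) (hk1 : k ≤ 1 / 16) (hv : v' ≤ v)
    (h : v ≤ v' + k) (hq : 0 < 1 - testProb v') :
    (1 - testProb v') * ((testProb v - testProb v') / (1 - testProb v')) ^ 2 ≤
      16 * k ^ 2 * testProb v' := by
  have hy := testRatio_mono hv
  have hy1 := testRatio_le_one v
  have hy0 := testRatio_pos v'
  have hr : (1 - testProb v') = (1 - testRatio v') ^ 2 := one_sub_testProb v'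
  have hr0 : 0 < 1 - testRatio v' := by
    rcases (testRatio_le_one v').eq_or_lt with h2 | h2
    · rw [hr, h2] at hq; norm_num at hq
    · linarith
  have hd : testProb v - testProb v' =
      (testRatio v - testRatio v') * (2 - testRatio v - testRatio v') := by
    unfold testProb; ring
  have hyk : testRatio v - testRatio v' ≤ 2 * k * testRatio v' := by
    calc testRatio v - testRatio v' ≤ Real.exp k * testRatio v' - testRatio v' := by
          gcongr; exact testRatio_le_exp_mul hk h
      _ ≤ (1 + 2 * k) * testRatio v' - testRatio v' := by
          gcongr; exact exp_le_one_add_two_mul hk hk1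
      _ = _ := by ring
  have hle : testRatio v' ^ 2 ≤ testProb v' := by
    have : testProb v' - testRatio v' ^ 2 = 2 * testRatio v' * (1 - testRatio v') := by
      unfold testProb; ring
    have h3 : 0 ≤ 2 * testRatio v' * (1 - testRatio v') := by positivity
    linarith
  have h4 : testProb v - testProb v' ≤ 2 * (2 * k * testRatio v') * (1 - testRatio v') := by
    rw [hd]
    calc _ ≤ (2 * k * testRatio v') * (2 * (1 - testRatio v')) := by
          gcongr <;> linarith
      _ = _ := by ring
  have h5 : 0 ≤ testProb v - testProb v' := by linarith [testProb_mono hv]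
  have h6 : (1 - testProb v') * ((testProb v - testProb v') / (1 - testProb v')) ^ 2 =
      ((testProb v - testProb v') / (1 - testRatio v')) ^ 2 := by
    rw [hr]; field_simp
  have h7 : (testProb v - testProb v') / (1 - testRatio v') ≤ 2 * (2 * k * testRatio v') := by
    rwa [div_le_iff₀ hr0]
  rw [h6]
  calc _ ≤ (2 * (2 * k * testRatio v')) ^ 2 := by
        have : 0 ≤ (testProb v - testProb v') / (1 - testRatio v') := by positivity
        gcongr
    _ = 16 * k ^ 2 * testRatio v' ^ 2 := by ring
    _ ≤ _ := by gcongr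

/-- The contribution of a negative outcome to the power divergence, to second order. -/
theorem neg_term_le_quadratic (hl : 1 ≤ l) (hk : 0 ≤ k) (hk1 : k ≤ 1 / 16) (hv : v' ≤ v)
    (h : v ≤ v' + k) :
    (1 - testProb v) * ((1 - testProb v) / (1 - testProb v')) ^ l ≤
      (1 - testProb v') - (1 + l) * (testProb v - testProb v') +
        64 * (testProb v' * (l * k) ^ 2) := by
  have hp := testProb_mono hv
  have hp0 := testProb_pos v'
  have hp1 := testProb_le_one v
  have hC : 0 ≤ 64 * (testProb v' * (l * k) ^ 2) := by positivity
  rcases (testProb_le_one v').eq_or_lt with h1 | h1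
  · have h2 : testProb v = 1 := le_antisymm hp1 (h1 ▸ hp)
    rw [h1] at hC
    simp only [h2, h1, sub_self, zero_mul, mul_zero, zero_add]
    exact hC
  have hq : 0 < 1 - testProb v' := by linarith
  have hqw2 := sq_sub_div_one_sub_testProb_le hk hk1 hv h hq
  have hB := mul_div_rpow_le_exp (x := 1 - testProb v) (by linarith) hq (by linarith : 0 ≤ l)
  have he : (1 - testProb v - (1 - testProb v')) / (1 - testProb v') =
      -((testProb v - testProb v') / (1 - testProb v')) := by ring
  rw [he, mul_neg] at hB
  have hqw : (1 - testProb v') * ((testProb v - testProb v') / (1 - testProb v')) =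
      testProb v - testProb v' := by field_simp
  have hw0 : 0 ≤ (testProb v - testProb v') / (1 - testProb v') := div_nonneg (by linarith) hq.le
  generalize (testProb v - testProb v') / (1 - testProb v') = w at *
  have hexpw := exp_neg_le_quadratic (x := (1 + l) * w) (by positivity)
  have hl2 : (1 + l) ^ 2 ≤ 4 * l ^ 2 := by nlinarith
  calc _ ≤ (1 - testProb v') * (1 - (1 + l) * w + ((1 + l) * w) ^ 2) := by
        refine hB.trans ?_; gcongr
    _ = (1 - testProb v') - (1 + l) * ((1 - testProb v') * w) +
        (1 + l) ^ 2 * ((1 - testProb v') * w ^ 2) := by ring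
    _ ≤ (1 - testProb v') - (1 + l) * ((1 - testProb v') * w) +
        (4 * l ^ 2) * (16 * k ^ 2 * testProb v') := by gcongr
    _ = _ := by rw [hqw]; ring

/-- The contribution of a positive outcome to the power divergence, to second order. The first-order
term is that of `neg_term_le_quadratic` with the opposite sign. -/
theorem pos_term_le_quadratic (hl : 1 ≤ l) (hk : 0 ≤ k) (hlk : l * k ≤ 1 / 16)
    (hk1 : k ≤ 1 / 16) (hv : v' ≤ v) (h : v ≤ v' + k) :
    testProb v * (testProb v / testProb v') ^ l * Real.exp (-(160 * (l * k) ^ 2)) ≤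
      testProb v' + (1 + l) * (testProb v - testProb v') -
        64 * (testProb v' * (l * k) ^ 2) := by
  have hp := testProb_mono hv
  have hp0 := testProb_pos v'
  have hμ1 : 160 * (l * k) ^ 2 ≤ 1 := by
    have : (l * k) ^ 2 ≤ (1 / 16) ^ 2 := by gcongr
    linarith
  have hexpμ := exp_neg_le_one_sub_half (x := 160 * (l * k) ^ 2) (by positivity) hμ1
  have hu1 := sub_div_testProb_le hk hk1 hv h
  have hu0 : 0 ≤ (testProb v - testProb v') / testProb v' := div_nonneg (by linarith) hp0.le
  have hpu : testProb v' * ((testProb v - testProb v') / testProb v') =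
      testProb v - testProb v' := by field_simp
  have hA := mul_div_rpow_le_exp (testProb_pos v).le hp0 (by linarith : 0 ≤ l)
  generalize (testProb v - testProb v') / testProb v' = u at *
  have hau : (1 + l) * u ≤ 4 * (l * k) := by
    calc (1 + l) * u ≤ (2 * l) * (2 * k) := by gcongr; linarith
      _ = _ := by ring
  have hau0 : 0 ≤ (1 + l) * u := by positivity
  have hexpu : Real.exp ((1 + l) * u) ≤ 1 + (1 + l) * u + ((1 + l) * u) ^ 2 := by
    have := abs_le.1 (Real.abs_exp_sub_one_sub_id_le (x := (1 + l) * u)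
      (by rw [abs_of_nonneg hau0]; linarith))
    linarith [this.2]
  have hau2 : ((1 + l) * u) ^ 2 ≤ (4 * (l * k)) ^ 2 := by gcongr
  have hge : 1 ≤ Real.exp ((1 + l) * u) := Real.one_le_exp hau0
  calc testProb v * (testProb v / testProb v') ^ l * Real.exp (-(160 * (l * k) ^ 2))
      ≤ testProb v' * Real.exp ((1 + l) * u) * (1 - 160 * (l * k) ^ 2 / 2) := by gcongr
    _ = testProb v' *
        (Real.exp ((1 + l) * u) - Real.exp ((1 + l) * u) * (80 * (l * k) ^ 2)) := by ring
    _ ≤ testProb v' * ((1 + (1 + l) * u + (4 * (l * k)) ^ 2) - 1 * (80 * (l * k) ^ 2)) := by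
        gcongr; linarith
    _ = testProb v' + (1 + l) * (testProb v' * u) - 64 * (testProb v' * (l * k) ^ 2) := by ring
    _ = _ := by rw [hpu]

/-- The power divergence of the outcome of a test under a shift of the threshold, when a positive
outcome is charged `160 * (l * k) ^ 2`: the first-order terms of the two outcomes cancel, and the
second-order terms are of the order of the probability of a positive outcome. -/
theorem divergence_le_one_of_quadratic_charge (hl : 1 ≤ l) (hk : 0 ≤ k) (hlk : l * k ≤ 1 / 16)
    (hv : v' ≤ v) (h : v ≤ v' + k) :
    testProb v * (testProb v / testProb v') ^ l * Real.exp (-(160 * (l * k) ^ 2)) +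
      (1 - testProb v) * ((1 - testProb v) / (1 - testProb v')) ^ l ≤ 1 := by
  have hk1 : k ≤ 1 / 16 := (le_mul_of_one_le_left hk hl).trans hlk
  linarith [neg_term_le_quadratic hl hk hk1 hv h, pos_term_le_quadratic hl hk hlk hk1 hv h]

end testProb

section Holder

/-- The weighted Hölder inequality for two points and weights of sum at most `1`. -/
theorem two_point_holder {b W₀ W₁ : ℝ} (hb : 1 ≤ b) (h0 : 0 ≤ W₀) (h1 : 0 ≤ W₁)
    (hW : W₀ + W₁ ≤ 1) (f₀ f₁ : ℝ≥0∞) :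
    ENNReal.ofReal W₀ * f₀ + ENNReal.ofReal W₁ * f₁ ≤
      (ENNReal.ofReal W₀ * f₀ ^ b + ENNReal.ofReal W₁ * f₁ ^ b) ^ (1 / b) := by
  have h := ENNReal.inner_le_weight_mul_Lp_of_nonneg Finset.univ hb
    ![ENNReal.ofReal W₀, ENNReal.ofReal W₁] ![f₀, f₁]
  simp only [Fin.sum_univ_two, Matrix.cons_val_zero, Matrix.cons_val_one] at h
  refine h.trans ?_
  rw [one_div]
  refine mul_le_of_le_one_left' (ENNReal.rpow_le_one ?_ ?_)
  · rw [← ENNReal.ofReal_add h0 h1]; exact ENNReal.ofReal_le_one.2 hW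
  · have := inv_le_one_of_one_le₀ hb; linarith

/-- One two-valued outcome with probabilities `p`, `1 - p` and `p'`, `1 - p'`: a bound on the power
divergence of order `1 + l`, in its dual form with the conjugate exponent `1 + 1 / l`. The outcome
of probability `p` is charged `μ`. -/
theorem two_point_dual_bound {p p' l μ : ℝ} (hl : 0 < l) (hp : 0 < p) (hp1 : p ≤ 1)
    (hp' : 0 < p') (hpp : p' ≤ p)
    (hdiv : p * (p / p') ^ l * Real.exp (-((1 + l) * μ)) +
      (1 - p) * ((1 - p) / (1 - p')) ^ l ≤ 1) (A B : ℝ≥0∞) :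
    ENNReal.ofReal p * A + ENNReal.ofReal (1 - p) * (ENNReal.ofReal (Real.exp μ) * B) ≤
      ENNReal.ofReal (Real.exp μ) *
        (ENNReal.ofReal p' * A ^ (1 + 1 / l) + ENNReal.ofReal (1 - p') * B ^ (1 + 1 / l)) ^
          (1 / (1 + 1 / l)) := by
  set b := 1 + 1 / l with hb
  have hb1 : 1 ≤ b := by rw [hb]; have : 0 < 1 / l := by positivity
                         linarith
  have hlb : l * b = 1 + l := by rw [hb]; field_simp; ring
  -- the weight and the factor that recover both pairs of probabilities
  have aux : ∀ x x' ν : ℝ, 0 < x → 0 < x' →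
      (x * (x / x') ^ l * Real.exp (-((1 + l) * ν))) * ((x / x') ^ (-l) * Real.exp (l * ν)) =
        x * Real.exp (-ν) ∧
      (x * (x / x') ^ l * Real.exp (-((1 + l) * ν))) *
        ((x / x') ^ (-l) * Real.exp (l * ν)) ^ b = x' := by
    intro x x' ν hx hx'
    have hr : 0 < x / x' := by positivity
    constructor
    · have h1 : (x / x') ^ l * (x / x') ^ (-l) = 1 := by
        rw [← Real.rpow_add hr]; simp
      calc _ = x * ((x / x') ^ l * (x / x') ^ (-l)) *
            (Real.exp (-((1 + l) * ν)) * Real.exp (l * ν)) := by ring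
        _ = _ := by rw [h1, ← Real.exp_add]; ring_nf
    · rw [Real.mul_rpow (by positivity) (by positivity), ← Real.rpow_mul hr.le, ← Real.exp_mul]
      have e1 : -l * b = -(1 + l) := by rw [neg_mul, hlb]
      have e2 : l * ν * b = (1 + l) * ν := by rw [← hlb]; ring
      rw [e1, e2]
      have h1 : (x / x') ^ l * (x / x') ^ (-(1 + l)) = (x / x')⁻¹ := by
        rw [← Real.rpow_add hr, ← Real.rpow_neg_one]; congr 1; ring
      calc _ = x * ((x / x') ^ l * (x / x') ^ (-(1 + l))) *
            (Real.exp (-((1 + l) * ν)) * Real.exp ((1 + l) * ν)) := by ring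
        _ = _ := by rw [h1, ← Real.exp_add]; simp; field_simp
  obtain ⟨a1, a2⟩ := aux p p' μ hp hp'
  set W₀ := p * (p / p') ^ l * Real.exp (-((1 + l) * μ))
  set F₀ := (p / p') ^ (-l) * Real.exp (l * μ)
  have hW₀ : 0 ≤ W₀ := by positivity
  have hF₀ : 0 < F₀ := by positivity
  obtain ⟨W₁, F₁, hW₁, hF₁, hW, b1, b2⟩ : ∃ W₁ F₁ : ℝ, 0 ≤ W₁ ∧ 0 < F₁ ∧ W₀ + W₁ ≤ 1 ∧
      W₁ * F₁ = 1 - p ∧ W₁ * F₁ ^ b ≤ 1 - p' := by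
    rcases hp1.eq_or_lt with h | h
    -- for `p = 1` the second outcome has probability `0` on the left, and any factor will do
    · refine ⟨0, 1, le_rfl, one_pos, ?_, by rw [h]; ring, by rw [zero_mul]; linarith⟩
      rw [h] at hdiv; simp only [sub_self, zero_mul, add_zero] at hdiv
      simpa [W₀, h] using hdiv
    · have hq : 0 < 1 - p := by linarith
      have hq' : 0 < 1 - p' := by linarith
      obtain ⟨b1, b2⟩ := aux (1 - p) (1 - p') 0 hq hq'
      simp only [mul_zero, neg_zero, Real.exp_zero, mul_one] at b1 b2
      exact ⟨_, _, by positivity, by positivity, hdiv, b1, b2.le⟩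
  have h := two_point_holder hb1 hW₀ hW₁ hW (ENNReal.ofReal F₀ * A) (ENNReal.ofReal F₁ * B)
  have hb0 : 0 ≤ b := by linarith
  rw [← mul_assoc, ← mul_assoc, ← ENNReal.ofReal_mul hW₀, ← ENNReal.ofReal_mul hW₁, a1, b1,
    ENNReal.mul_rpow_of_nonneg _ _ hb0, ENNReal.mul_rpow_of_nonneg _ _ hb0,
    ENNReal.ofReal_rpow_of_pos hF₀, ENNReal.ofReal_rpow_of_pos hF₁, ← mul_assoc, ← mul_assoc,
    ← ENNReal.ofReal_mul hW₀, ← ENNReal.ofReal_mul hW₁, a2] at h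
  have hE : ENNReal.ofReal (Real.exp μ) * ENNReal.ofReal (p * Real.exp (-μ)) =
      ENNReal.ofReal p := by
    rw [← ENNReal.ofReal_mul (Real.exp_pos _).le]
    congr 1
    rw [mul_left_comm, ← Real.exp_add]; simp
  calc _ = ENNReal.ofReal (Real.exp μ) * (ENNReal.ofReal (p * Real.exp (-μ)) * A +
        ENNReal.ofReal (1 - p) * B) := by
        rw [mul_add, ← mul_assoc (ENNReal.ofReal (Real.exp μ)), hE,
          mul_left_comm (ENNReal.ofReal (Real.exp μ))]
    _ ≤ _ := by
        gcongr
        refine h.trans ?_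
        gcongr

end Holder

/-! ### Privacy of one round, exponential noise, and sensitivity -/

section roundPrivacy

variable {X : Type u}

/-- The translation of hidden states from one dataset to a neighboring one: the histogram moves
by `e`, and the threshold is raised by the sensitivity `Δ`, so that no test becomes more likely to
be positive. -/
def translateState (e : X → ℝ) (Δ : ℝ) (s : PMWState X) : PMWState X :=
  (s.1, s.2.1 + e, s.2.2.1 + Δ, s.2.2.2.1, s.2.2.2.2)

theorem measurable_translateState (e : X → ℝ) (Δ : ℝ) : Measurable (translateState e Δ) := by
  unfold translateState; fun_prop

variable [Fintype X]

theorem queryMean_add (a e : X → ℝ) (f : LinearQuery X) :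
    queryMean (a + e) f = queryMean a f + queryMean e f := by
  simp [queryMean, add_mul, Finset.sum_add_distrib]

theorem testExponent_translate {κ Δ : ℝ} (hκ : 0 ≤ κ) {e : X → ℝ}
    (he : ∀ f : LinearQuery X, |queryMean e f| ≤ Δ) {sgn : ℝ} (hs : |sgn| = 1) (τ : ℝ)
    (c : X → ℝ) (z : ℝ) (w : X → ℝ) (f : LinearQuery X) :
    testExponent κ τ sgn (c + e) (z + Δ) w f ≤ testExponent κ τ sgn c z w f ∧
      testExponent κ τ sgn c z w f ≤
        testExponent κ τ sgn (c + e) (z + Δ) w f + 2 * κ * Δ := by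
  have h : |sgn * queryMean e f| ≤ Δ := by rw [abs_mul, hs, one_mul]; exact he f
  have h1 := abs_le.1 h
  have hd : testExponent κ τ sgn (c + e) (z + Δ) w f =
      testExponent κ τ sgn c z w f + κ * (sgn * queryMean e f - Δ) := by
    unfold testExponent; rw [queryMean_add]; ring
  rw [hd]
  constructor
  · nlinarith
  · nlinarith

/-- Privacy of one round, in dual form: each update is charged `μ`. -/
theorem pmwRound_translate_le {κ τ Δ l μ : ℝ} (hκ : 0 ≤ κ) (hl : 0 < l)
    (hdiv : ∀ v v' : ℝ, v' ≤ v → v ≤ v' + 2 * κ * Δ →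
      testProb v * (testProb v / testProb v') ^ l * Real.exp (-((1 + l) * μ)) +
        (1 - testProb v) * ((1 - testProb v) / (1 - testProb v')) ^ l ≤ 1)
    {e : X → ℝ} (he : ∀ f : LinearQuery X, |queryMean e f| ≤ Δ)
    (o : (X → ℝ) × ℝ) (c : X → ℝ) (z : ℝ) (f : LinearQuery X) (r : ℕ) (w : X → ℝ)
    {φ : ℝ × PMWState X → ℝ≥0∞} (hφ : Measurable φ) :
    ∫⁻ a, φ (a.1, translateState e Δ a.2) * ENNReal.ofReal (Real.exp μ) ^ a.2.2.2.2.1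
        ∂(pmwRound κ τ o c z f r w) ≤
      ENNReal.ofReal (Real.exp μ) ^ r *
        (∫⁻ a, φ a ^ (1 + 1 / l) ∂(pmwRound κ τ o (c + e) (z + Δ) f r w)) ^
          (1 / (1 + 1 / l)) := by
  have hb : 0 < 1 + 1 / l := by positivity
  have hroot : ∀ A : ℝ≥0∞, (A ^ (1 / (1 + 1 / l))) ^ (1 + 1 / l) = A := fun A => by
    rw [← ENNReal.rpow_mul, one_div_mul_cancel hb.ne', ENNReal.rpow_one]
  have hroot' : ∀ A : ℝ≥0∞, (A ^ (1 + 1 / l)) ^ (1 / (1 + 1 / l)) = A := fun A => by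
    rw [← ENNReal.rpow_mul, mul_one_div_cancel hb.ne', ENNReal.rpow_one]
  have hm1 : Measurable fun a : ℝ × PMWState X =>
      φ (a.1, translateState e Δ a.2) * ENNReal.ofReal (Real.exp μ) ^ a.2.2.2.2.1 := by
    refine (hφ.comp (measurable_fst.prodMk
      ((measurable_translateState e Δ).comp measurable_snd))).mul ?_
    exact (measurable_of_countable
      fun r : ℕ => ENNReal.ofReal (Real.exp μ) ^ r).comp (by fun_prop)
  have hm2 : Measurable fun a => φ a ^ (1 + 1 / l) := hφ.pow_const _
  induction r generalizing w with
  | zero =>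
    rw [pmwRound, pmwRound, lintegral_dirac' _ hm1, lintegral_dirac' _ hm2, hroot']
    simp [translateState]
  | succ r ih =>
    have hbin : ∀ sgn : ℝ, |sgn| = 1 → ∀ A B : ℝ≥0∞,
        ENNReal.ofReal (testProb (testExponent κ τ sgn c z w f)) * A +
          ENNReal.ofReal (1 - testProb (testExponent κ τ sgn c z w f)) *
            (ENNReal.ofReal (Real.exp μ) * B) ≤
        ENNReal.ofReal (Real.exp μ) *
          (ENNReal.ofReal (testProb (testExponent κ τ sgn (c + e) (z + Δ) w f)) *
              A ^ (1 + 1 / l) +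
            ENNReal.ofReal (1 - testProb (testExponent κ τ sgn (c + e) (z + Δ) w f)) *
              B ^ (1 + 1 / l)) ^ (1 / (1 + 1 / l)) := by
      intro sgn hs A B
      obtain ⟨h1, h2⟩ := testExponent_translate hκ he hs τ c z w f
      exact two_point_dual_bound hl (testProb_pos _) (testProb_le_one _) (testProb_pos _)
        (testProb_mono h1) (hdiv _ _ h1 h2) A B
    rw [lintegral_pmwRound_succ _ _ _ _ _ _ _ _ hm1, lintegral_pmwRound_succ _ _ _ _ _ _ _ _ hm2]
    set E := ENNReal.ofReal (Real.exp μ)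
    set b := 1 + 1 / l
    have i1 := ih (mwUpdate (τ / 2) w f)
    have i2 := ih (mwUpdate (-(τ / 2)) w f)
    generalize (∫⁻ a, φ a ^ b ∂(pmwRound κ τ o (c + e) (z + Δ) f r (mwUpdate (τ / 2) w f))) = A₁
      at i1 ⊢
    generalize (∫⁻ a, φ a ^ b ∂(pmwRound κ τ o (c + e) (z + Δ) f r
      (mwUpdate (-(τ / 2)) w f))) = A₂ at i2 ⊢
    have e0 : φ (pmwAnswer o w f, translateState e Δ (o, c, z, r + 1, w)) =
        φ (pmwAnswer o w f, (o, c + e, z + Δ, r + 1, w)) := rfl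
    simp only [e0]
    generalize φ (pmwAnswer o w f, (o, c + e, z + Δ, r + 1, w)) = A₀
    have h2 := hbin (-1) (by simp) (A₂ ^ (1 / b)) A₀
    rw [hroot] at h2
    have h1 := hbin 1 (by simp) (A₁ ^ (1 / b))
      ((ENNReal.ofReal (testProb (testExponent κ τ (-1) (c + e) (z + Δ) w f)) * A₂ +
        ENNReal.ofReal (1 - testProb (testExponent κ τ (-1) (c + e) (z + Δ) w f)) *
          A₀ ^ b) ^ (1 / b))
    rw [hroot, hroot] at h1
    generalize ENNReal.ofReal (testProb (testExponent κ τ 1 c z w f)) = p₁ at *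
    generalize ENNReal.ofReal (1 - testProb (testExponent κ τ 1 c z w f)) = q₁ at *
    generalize ENNReal.ofReal (testProb (testExponent κ τ (-1) c z w f)) = p₂ at *
    generalize ENNReal.ofReal (1 - testProb (testExponent κ τ (-1) c z w f)) = q₂ at *
    calc _ ≤ p₁ * (E ^ r * A₁ ^ (1 / b)) +
          q₁ * (p₂ * (E ^ r * A₂ ^ (1 / b)) + q₂ * (A₀ * E ^ (r + 1))) := by gcongr
      _ = E ^ r * (p₁ * A₁ ^ (1 / b) + q₁ * (p₂ * A₂ ^ (1 / b) + q₂ * (E * A₀))) := by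
          rw [pow_succ]; ring
      _ ≤ E ^ r * (p₁ * A₁ ^ (1 / b) + q₁ * (E * _)) := by gcongr
      _ ≤ E ^ r * (E * _) := by gcongr
      _ = _ := by rw [← mul_assoc, ← pow_succ]

end roundPrivacy

section expShift

theorem exponentialPDF_le_shift {θ Δ : ℝ} (hΔ : 0 ≤ Δ) (x : ℝ) :
    exponentialPDF θ x ≤ ENNReal.ofReal (Real.exp (θ * Δ)) * exponentialPDF θ (x + Δ) := by
  rcases lt_or_ge x 0 with h | h
  · rw [exponentialPDF_of_neg h]; exact zero_le
  · rw [exponentialPDF_of_nonneg h, exponentialPDF_of_nonneg (by linarith),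
      ← ENNReal.ofReal_mul (Real.exp_pos _).le]
    apply le_of_eq
    congr 1
    rw [mul_left_comm, ← Real.exp_add]; ring_nf

theorem lintegral_expMeasure (θ : ℝ) {g : ℝ → ℝ≥0∞} (hg : Measurable g) :
    ∫⁻ x, g x ∂(expMeasure θ) = ∫⁻ x, exponentialPDF θ x * g x := by
  have hm : Measurable (exponentialPDF θ) := (measurable_exponentialPDFReal θ).ennreal_ofReal
  exact lintegral_withDensity_eq_lintegral_mul _ hm hg

/-- A translation of exponential noise to the right costs a factor `exp (θ * Δ)`. -/
theorem lintegral_expMeasure_shift_le {θ Δ : ℝ} (hΔ : 0 ≤ Δ) {g : ℝ → ℝ≥0∞}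
    (hg : Measurable g) :
    ∫⁻ x, g (x + Δ) ∂(expMeasure θ) ≤
      ENNReal.ofReal (Real.exp (θ * Δ)) * ∫⁻ x, g x ∂(expMeasure θ) := by
  have hg' : Measurable fun x => g (x + Δ) :=
    hg.comp (by fun_prop : Measurable fun x : ℝ => x + Δ)
  rw [lintegral_expMeasure θ hg', lintegral_expMeasure θ hg]
  have hm : Measurable (exponentialPDF θ) := (measurable_exponentialPDFReal θ).ennreal_ofReal
  calc ∫⁻ x, exponentialPDF θ x * g (x + Δ)
      ≤ ∫⁻ x, ENNReal.ofReal (Real.exp (θ * Δ)) *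
          (exponentialPDF θ (x + Δ) * g (x + Δ)) := by
        refine lintegral_mono fun x => ?_
        rw [← mul_assoc]
        gcongr
        exact exponentialPDF_le_shift hΔ x
    _ = ENNReal.ofReal (Real.exp (θ * Δ)) *
          ∫⁻ x, exponentialPDF θ (x + Δ) * g (x + Δ) :=
        lintegral_const_mul _ ((hm.mul hg).comp (by fun_prop : Measurable fun x : ℝ => x + Δ))
    _ = _ := by
        rw [lintegral_add_right_eq_self (fun x => exponentialPDF θ x * g x) Δ]

theorem ae_nonneg_expMeasure (θ : ℝ) : ∀ᵐ x ∂(expMeasure θ), 0 ≤ x := by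
  have hm : MeasurableSet {x : ℝ | ¬ 0 ≤ x} := by
    simp only [not_le]; exact measurableSet_Iio
  rw [ae_iff, ← lintegral_indicator_one hm, lintegral_expMeasure θ (measurable_one.indicator hm)]
  refine lintegral_eq_zero_of_ae_eq_zero (Filter.Eventually.of_forall fun x => ?_)
  by_cases h : 0 ≤ x
  · simp [h]
  · simp [exponentialPDF_of_neg (not_le.1 h)]

theorem expMeasure_Iic {θ x : ℝ} (hθ : 0 < θ) (hx : 0 ≤ x) :
    expMeasure θ (Set.Iic x) = ENNReal.ofReal (1 - Real.exp (-(θ * x))) := by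
  have := isProbabilityMeasure_expMeasure hθ
  have h := cdf_expMeasure_eq hθ x
  rw [if_pos hx] at h
  rw [← h, ofReal_cdf]

theorem expMeasure_Ioi {θ x : ℝ} (hθ : 0 < θ) (hx : 0 ≤ x) :
    expMeasure θ (Set.Ioi x) = ENNReal.ofReal (Real.exp (-(θ * x))) := by
  have := isProbabilityMeasure_expMeasure hθ
  rw [← Set.compl_Iic, prob_compl_eq_one_sub measurableSet_Iic, expMeasure_Iic hθ hx,
    ENNReal.ofReal_sub _ (Real.exp_pos _).le, ENNReal.ofReal_one,
    ENNReal.sub_sub_cancel ENNReal.one_ne_top]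
  exact ENNReal.ofReal_le_one.2 (Real.exp_le_one_iff.2 (by nlinarith))

end expShift

section histogram

variable {X : Type u} {n : ℕ}

theorem blockHistogram_congr {Q : Finset (Fin n)} {S S' : Fin n → X} (h : ∀ i ∈ Q, S i = S' i) :
    blockHistogram Q S = blockHistogram Q S' := by
  classical
  funext x
  unfold blockHistogram
  exact Finset.sum_congr rfl fun i hi => by rw [h i hi]

variable [Fintype X]

theorem queryMean_blockHistogram (Q : Finset (Fin n)) (S : Fin n → X) (N : ℝ)
    (f : LinearQuery X) :
    queryMean (fun x => blockHistogram Q S x / N) f = (∑ j ∈ Q, (f (S j) : ℝ)) / N := by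
  classical
  have h : ∀ x, blockHistogram Q S x = ∑ j ∈ Q, if S j = x then (1 : ℝ) else 0 := fun x => by
    unfold blockHistogram; congr! 1
  simp only [queryMean, h, Finset.sum_div, Finset.sum_mul]
  rw [Finset.sum_comm]
  refine Finset.sum_congr rfl fun j _ => ?_
  rw [Finset.sum_eq_single (S j)]
  · simp; ring
  · intro x _ hx; simp [hx.symm]
  · simp

/-- The sensitivity of a query on the private part of the dataset. -/
theorem abs_queryMean_sub_le {Q : Finset (Fin n)} {S S' : Fin n → X} {j : Fin n} (hj : j ∈ Q)
    (h : ∀ i, i ≠ j → S i = S' i) (f : LinearQuery X) :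
    |queryMean ((fun x => blockHistogram Q S' x / Q.card) -
      fun x => blockHistogram Q S x / Q.card) f| ≤ 1 / Q.card := by
  have h1 : queryMean ((fun x => blockHistogram Q S' x / (Q.card : ℝ)) -
      fun x => blockHistogram Q S x / (Q.card : ℝ)) f =
      (∑ j ∈ Q, (f (S' j) : ℝ)) / Q.card - (∑ j ∈ Q, (f (S j) : ℝ)) / Q.card := by
    rw [← queryMean_blockHistogram, ← queryMean_blockHistogram]
    simp [queryMean, sub_mul]
  rw [h1, ← sub_div, ← Finset.sum_sub_distrib, Finset.sum_eq_single j]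
  · rw [abs_div, Nat.abs_cast]
    gcongr
    rw [abs_le]
    constructor <;> linarith [(f (S' j)).2.1, (f (S' j)).2.2, (f (S j)).2.1, (f (S j)).2.2]
  · intro i _ hi; rw [h i hi]; simp
  · exact fun h => absurd hj h

end histogram

/-! ### Privacy of private multiplicative weights -/

/-- From a power divergence (in dual form) to `(ε, δ)`-indistinguishability, by weighting the two
sides of Young's inequality. -/
theorem dual_bound_le {l μ ε δ : ℝ} (hl : 0 < l) (hδ : 0 < δ) (T : ℕ)
    (h : (1 + l) * μ * T - l * ε ≤ Real.log δ) (q : ℝ≥0∞) :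
    ENNReal.ofReal (Real.exp μ) ^ T * q ^ (1 / (1 + 1 / l)) ≤
      ENNReal.ofReal (Real.exp ε) * q + ENNReal.ofReal δ := by
  have hb : 1 / (1 + 1 / l) = l / (1 + l) := by field_simp; ring
  have hl1 : 0 < 1 + l := by linarith
  have h1 : ENNReal.ofReal (Real.exp μ) ^ T ≤
      ENNReal.ofReal (Real.exp ε) ^ (l / (1 + l)) * ENNReal.ofReal δ ^ (1 / (1 + l)) := by
    rw [ENNReal.ofReal_rpow_of_pos (Real.exp_pos _), ENNReal.ofReal_rpow_of_pos hδ,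
      ← ENNReal.ofReal_mul (by positivity), ← ENNReal.ofReal_pow (Real.exp_pos _).le]
    refine ENNReal.ofReal_le_ofReal ?_
    rw [← Real.exp_nat_mul, ← Real.exp_mul, Real.rpow_def_of_pos hδ, ← Real.exp_add]
    refine Real.exp_le_exp.2 ?_
    rw [mul_one_div, mul_div_assoc', ← add_div, le_div_iff₀ hl1]
    linarith
  set M := max (ENNReal.ofReal (Real.exp ε) * q) (ENNReal.ofReal δ) with hM
  calc ENNReal.ofReal (Real.exp μ) ^ T * q ^ (1 / (1 + 1 / l))
      ≤ (ENNReal.ofReal (Real.exp ε) ^ (l / (1 + l)) * ENNReal.ofReal δ ^ (1 / (1 + l))) *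
          q ^ (l / (1 + l)) := by rw [hb]; gcongr
    _ = (ENNReal.ofReal (Real.exp ε) * q) ^ (l / (1 + l)) *
          ENNReal.ofReal δ ^ (1 / (1 + l)) := by
        rw [ENNReal.mul_rpow_of_nonneg _ _ (by positivity : 0 ≤ l / (1 + l))]; ring
    _ ≤ M ^ (l / (1 + l)) * M ^ (1 / (1 + l)) := by
        gcongr
        · exact le_max_left _ _
        · exact le_max_right _ _
    _ = M := by
        rw [← ENNReal.rpow_add_of_nonneg _ _ (by positivity) (by positivity), ← add_div,
          add_comm l, div_self hl1.ne', ENNReal.rpow_one]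
    _ ≤ _ := max_le (le_add_of_nonneg_right zero_le) (le_add_of_nonneg_left zero_le)

namespace InteractiveMechanism

variable {X : Type u} {n : ℕ} (M : InteractiveMechanism X n) (B : QueryAdversary X)

theorem measurable_indicator_fst {m : ℕ} {E : Set (Transcript X m)} (hE : MeasurableSet E) :
    Measurable fun p : Transcript X m × M.State => E.indicator (1 : Transcript X m → ℝ≥0∞) p.1 :=
  (measurable_one.indicator hE).comp measurable_fst

theorem transcriptLaw_apply (S : Fin n → X) {m : ℕ} {E : Set (Transcript X m)}
    (hE : MeasurableSet E) :
    M.transcriptLaw B S m E =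
      ∫⁻ s, M.value B m (fun p => E.indicator 1 p.1) s ∂(M.init S) := by
  rw [← M.lintegral_run B S (M.measurable_indicator_fst hE), transcriptLaw,
    ← lintegral_indicator_one hE, lintegral_map (measurable_one.indicator hE) measurable_fst]

theorem value_indicator_le_one {m : ℕ} (E : Set (Transcript X m)) (s : M.State) :
    M.value B m (fun p => E.indicator 1 p.1) s ≤ 1 := by
  rw [← M.value_one B m s]
  exact M.value_mono B (fun p => Set.indicator_le_self' (fun _ _ => zero_le) _) s

end InteractiveMechanism

section privacy

variable {X : Type u} [Fintype X] {n : ℕ}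

theorem pmwMechanism_transcriptLaw (κ τ : ℝ) (T : ℕ) {θ : ℝ} (hθ : 0 < θ) {ι : Type} [Fintype ι]
    (Q : ι → Finset (Fin n)) (q : ι → ℝ≥0∞) (hq : ∑ i, q i = 1) (B : QueryAdversary X)
    (S : Fin n → X) {m : ℕ} {E : Set (Transcript X m)} (hE : MeasurableSet E) :
    (pmwMechanism κ τ T hθ Q q hq).transcriptLaw B S m E =
      ∑ i, q i * ∫⁻ z, (pmwMechanism κ τ T hθ Q q hq).value B m (fun p => E.indicator 1 p.1)
        (pmwStart T (Q i) S z) ∂(expMeasure θ) := by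
  rw [InteractiveMechanism.transcriptLaw_apply _ _ _ hE]
  have hm := (pmwMechanism (X := X) κ τ T hθ Q q hq).measurable_value B
    ((pmwMechanism (X := X) κ τ T hθ Q q hq).measurable_indicator_fst hE)
  simp only [lintegral_finsetSum_measure, lintegral_smul_measure, smul_eq_mul]
  refine Finset.sum_congr rfl fun i _ => ?_
  rw [lintegral_map hm (measurable_pmwStart T (Q i) S)]

/-- Privacy of the interaction for a fixed choice of the private part: the noise of the threshold
and the updates each consume half of `ε`. -/
theorem pmwMechanism_block_private {κ τ ε δ θ Δ l μ : ℝ} {T : ℕ} (hκ : 0 ≤ κ) (hΔ : 0 ≤ Δ)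
    (hμ : 0 ≤ μ) (hl : 0 < l) (hδ : 0 < δ) (hθ : 0 < θ) (hθΔ : θ * Δ ≤ ε / 2)
    (hdiv : ∀ v v' : ℝ, v' ≤ v → v ≤ v' + 2 * κ * Δ →
      testProb v * (testProb v / testProb v') ^ l * Real.exp (-((1 + l) * μ)) +
        (1 - testProb v) * ((1 - testProb v) / (1 - testProb v')) ^ l ≤ 1)
    (hbudget : (1 + l) * μ * T - l * (ε / 2) ≤ Real.log δ)
    {ι : Type} [Fintype ι] (Q : ι → Finset (Fin n)) (q : ι → ℝ≥0∞) (hq : ∑ i, q i = 1)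
    (B : QueryAdversary X) {m : ℕ} {E : Set (Transcript X m)} (hE : MeasurableSet E)
    {S S' : Fin n → X} {j : Fin n} (hS : ∀ i, i ≠ j → S i = S' i) {i : ι} (hj : j ∈ Q i)
    (hQΔ : 1 / ((Q i).card : ℝ) ≤ Δ) :
    ∫⁻ z, (pmwMechanism κ τ T hθ Q q hq).value B m (fun p => E.indicator 1 p.1)
        (pmwStart T (Q i) S z) ∂(expMeasure θ) ≤
      ENNReal.ofReal (Real.exp ε) *
        ∫⁻ z, (pmwMechanism κ τ T hθ Q q hq).value B m (fun p => E.indicator 1 p.1)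
          (pmwStart T (Q i) S' z) ∂(expMeasure θ) + ENNReal.ofReal δ := by
  set M := pmwMechanism (X := X) κ τ T hθ Q q hq with hM
  have := isProbabilityMeasure_expMeasure hθ
  have hm := M.measurable_value B (M.measurable_indicator_fst hE)
  have hm' : Measurable fun z => M.value B m (fun p => E.indicator 1 p.1)
      (pmwStart T (Q i) S' z) := hm.comp (measurable_pmwStart T (Q i) S')
  set e : X → ℝ := (fun x => blockHistogram (Q i) S' x / ((Q i).card : ℝ)) -
    fun x => blockHistogram (Q i) S x / ((Q i).card : ℝ) with he
  have hstart : ∀ z, translateState e Δ (pmwStart T (Q i) S z) =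
      pmwStart T (Q i) S' (z + Δ) := by
    intro z
    have : blockHistogram (Q i)ᶜ S = blockHistogram (Q i)ᶜ S' :=
      blockHistogram_congr fun k hk => hS k fun hkj => Finset.mem_compl.1 hk (hkj ▸ hj)
    simp [translateState, pmwStart, this, he]
  have hE1 : 1 ≤ ENNReal.ofReal (Real.exp μ) :=
    ENNReal.one_le_ofReal.2 (Real.one_le_exp hμ)
  have hb : 1 < 1 + 1 / l := by have : 0 < 1 / l := by positivity
                                linarith
  have hstep : ∀ z, M.value B m (fun p => E.indicator 1 p.1) (pmwStart T (Q i) S z) ≤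
      ENNReal.ofReal (Real.exp (ε / 2)) * M.value B m (fun p => E.indicator 1 p.1)
        (pmwStart T (Q i) S' (z + Δ)) + ENNReal.ofReal δ := by
    intro z
    have h := M.value_translate_le B hb (translateState e Δ)
      (fun s => ENNReal.ofReal (Real.exp μ) ^ s.2.2.2.1)
      (fun s f φ hφ => pmwRound_translate_le hκ hl hdiv
        (fun f => (abs_queryMean_sub_le hj hS f).trans hQΔ) s.1 s.2.1 s.2.2.1 f s.2.2.2.1
        s.2.2.2.2 hφ) (m := m) (M.measurable_indicator_fst hE) (pmwStart T (Q i) S z)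
    rw [hstart] at h
    have hpow : (fun p : Transcript X m × M.State =>
        (E.indicator (1 : Transcript X m → ℝ≥0∞) p.1) ^ (1 + 1 / l)) =
        fun p => E.indicator 1 p.1 := by
      funext p
      by_cases hp : p.1 ∈ E
      · simp [hp]
      · simp [hp, show 0 < 1 + l⁻¹ by positivity]
    rw [hpow] at h
    refine (M.value_mono B (fun p => ?_) _).trans
      (h.trans (dual_bound_le hl hδ T hbudget _))
    exact le_mul_of_one_le_right' (one_le_pow₀ hE1)
  calc _ ≤ ∫⁻ z, (ENNReal.ofReal (Real.exp (ε / 2)) * M.value B m (fun p => E.indicator 1 p.1)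
        (pmwStart T (Q i) S' (z + Δ)) + ENNReal.ofReal δ) ∂(expMeasure θ) :=
        lintegral_mono hstep
    _ = ENNReal.ofReal (Real.exp (ε / 2)) * ∫⁻ z, M.value B m (fun p => E.indicator 1 p.1)
        (pmwStart T (Q i) S' (z + Δ)) ∂(expMeasure θ) + ENNReal.ofReal δ := by
        rw [lintegral_add_right _ measurable_const, lintegral_const_mul]
        · simp
        · exact hm'.comp (by fun_prop : Measurable fun z : ℝ => z + Δ)
    _ ≤ ENNReal.ofReal (Real.exp (ε / 2)) * (ENNReal.ofReal (Real.exp (ε / 2)) *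
          ∫⁻ z, M.value B m (fun p => E.indicator 1 p.1)
            (pmwStart T (Q i) S' z) ∂(expMeasure θ)) + ENNReal.ofReal δ := by
        gcongr
        refine (lintegral_expMeasure_shift_le hΔ hm').trans ?_
        gcongr
    _ = _ := by
        rw [← mul_assoc, ← ENNReal.ofReal_mul (Real.exp_pos _).le, ← Real.exp_add, add_halves]

/-- Privacy of a random choice of the private part: an entry that is public may be revealed, so
that only the probability of being private reduces `δ`. -/
theorem pmwMechanism_isDifferentiallyPrivate {κ τ ε δ δ' θ Δ l μ : ℝ} {T : ℕ} (hκ : 0 ≤ κ)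
    (hΔ : 0 ≤ Δ) (hμ : 0 ≤ μ) (hl : 0 < l) (hδ : 0 < δ) (hθ : 0 < θ) (hθΔ : θ * Δ ≤ ε / 2)
    (hdiv : ∀ v v' : ℝ, v' ≤ v → v ≤ v' + 2 * κ * Δ →
      testProb v * (testProb v / testProb v') ^ l * Real.exp (-((1 + l) * μ)) +
        (1 - testProb v) * ((1 - testProb v) / (1 - testProb v')) ^ l ≤ 1)
    (hbudget : (1 + l) * μ * T - l * (ε / 2) ≤ Real.log δ)
    {ι : Type} [Fintype ι] (Q : ι → Finset (Fin n)) (q : ι → ℝ≥0∞) (hq : ∑ i, q i = 1)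
    (hQΔ : ∀ i j, j ∈ Q i → 1 / ((Q i).card : ℝ) ≤ Δ)
    (hδ' : ∀ j, ∑ i, q i * (if j ∈ Q i then ENNReal.ofReal δ else 1) ≤ ENNReal.ofReal δ')
    (m : ℕ) :
    (pmwMechanism (X := X) κ τ T hθ Q q hq).IsDifferentiallyPrivate m ε δ' := by
  rintro B S S' ⟨j, hS⟩ E hE
  have := isProbabilityMeasure_expMeasure hθ
  rw [pmwMechanism_transcriptLaw κ τ T hθ Q q hq B S hE,
    pmwMechanism_transcriptLaw κ τ T hθ Q q hq B S' hE]
  refine le_trans ?_ (add_le_add_right (hδ' j) _)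
  rw [Finset.mul_sum, ← Finset.sum_add_distrib]
  refine Finset.sum_le_sum fun i _ => ?_
  rw [mul_left_comm, ← mul_add]
  gcongr
  split_ifs with hj
  · exact pmwMechanism_block_private hκ hΔ hμ hl hδ hθ hθΔ hdiv hbudget Q q hq B hE hS hj
      (hQΔ i j hj)
  · refine le_add_of_nonneg_of_le zero_le ?_
    refine (lintegral_mono fun z => InteractiveMechanism.value_indicator_le_one _ B E _).trans ?_
    simp

end privacy

/-! ### The potential and the probability of running out of updates -/

section potential

variable {X : Type u} [Fintype X]

theorem queryMean_mem_Icc {a : X → ℝ} (h0 : ∀ x, 0 ≤ a x) (h1 : ∑ x, a x = 1)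
    (f : LinearQuery X) : queryMean a f ∈ Set.Icc (0 : ℝ) 1 := by
  constructor
  · exact Finset.sum_nonneg fun x _ => mul_nonneg (h0 x) (f x).2.1
  · rw [← h1]
    exact Finset.sum_le_sum fun x _ => mul_le_of_le_one_right (h0 x) (f x).2.2

theorem softmax_nonneg (w : X → ℝ) (x : X) : 0 ≤ softmax w x := by
  unfold softmax; positivity

theorem sum_exp_pos [Nonempty X] (w : X → ℝ) : 0 < ∑ x, Real.exp (w x) :=
  Finset.sum_pos (fun _ _ => Real.exp_pos _) Finset.univ_nonempty

theorem sum_softmax [Nonempty X] (w : X → ℝ) : ∑ x, softmax w x = 1 := by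
  unfold softmax
  rw [← Finset.sum_div, div_self (sum_exp_pos w).ne']

/-- The potential of the multiplicative weights method: the relative entropy of the hypothesis
with respect to the probability vector `c`, up to the entropy of `c`. -/
noncomputable def mwPotential (c w : X → ℝ) : ℝ :=
  Real.log (∑ x, Real.exp (w x)) - ∑ x, c x * w x

theorem mwPotential_zero (c : X → ℝ) : mwPotential c 0 = Real.log (Fintype.card X) := by
  simp [mwPotential]

theorem mwPotential_nonneg [Nonempty X] {c : X → ℝ} (h0 : ∀ x, 0 ≤ c x) (h1 : ∑ x, c x = 1)
    (w : X → ℝ) : 0 ≤ mwPotential c w := by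
  have h : ∑ x, c x * w x ≤ ∑ x, c x * Real.log (∑ y, Real.exp (w y)) := by
    refine Finset.sum_le_sum fun x _ => mul_le_mul_of_nonneg_left ?_ (h0 x)
    rw [Real.le_log_iff_exp_le (sum_exp_pos w)]
    exact Finset.single_le_sum (f := fun y => Real.exp (w y)) (fun y _ => (Real.exp_pos _).le)
      (Finset.mem_univ x)
  rw [← Finset.sum_mul, h1, one_mul] at h
  unfold mwPotential; linarith

/-- The multiplicative weights inequality. -/
theorem mwPotential_update_le [Nonempty X] {η : ℝ} (hη : |η| ≤ 1) (c w : X → ℝ)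
    (f : LinearQuery X) :
    mwPotential c (mwUpdate η w f) ≤
      mwPotential c w - η * (queryMean c f - queryMean (softmax w) f) + η ^ 2 := by
  have hZ := sum_exp_pos w
  have h1 : ∑ x, Real.exp (mwUpdate η w f x) ≤
      (∑ x, Real.exp (w x)) * Real.exp (η * queryMean (softmax w) f + η ^ 2) := by
    have hx : ∀ x, Real.exp (mwUpdate η w f x) ≤
        Real.exp (w x) * (1 + η * (f x : ℝ) + η ^ 2) := fun x => by
      have hf := (f x).2
      have ha : |η * (f x : ℝ)| ≤ 1 := by
        rw [abs_mul, abs_of_nonneg hf.1]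
        exact mul_le_one₀ hη hf.1 hf.2
      have he := (abs_le.1 (Real.abs_exp_sub_one_sub_id_le ha)).2
      have hsq : (η * (f x : ℝ)) ^ 2 ≤ η ^ 2 := by
        rw [mul_pow]
        exact mul_le_of_le_one_right (sq_nonneg _) (pow_le_one₀ hf.1 hf.2)
      rw [mwUpdate, Real.exp_add]
      gcongr
      linarith
    calc _ ≤ ∑ x, Real.exp (w x) * (1 + η * (f x : ℝ) + η ^ 2) :=
          Finset.sum_le_sum fun x _ => hx x
      _ = (∑ x, Real.exp (w x)) * (1 + η ^ 2) + η * ∑ x, Real.exp (w x) * (f x : ℝ) := by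
          rw [Finset.sum_mul, Finset.mul_sum, ← Finset.sum_add_distrib]
          exact Finset.sum_congr rfl fun x _ => by ring
      _ = (∑ x, Real.exp (w x)) * (η * queryMean (softmax w) f + η ^ 2 + 1) := by
          have : ∑ x, Real.exp (w x) * (f x : ℝ) =
              (∑ x, Real.exp (w x)) * queryMean (softmax w) f := by
            unfold queryMean softmax
            rw [Finset.mul_sum]
            exact Finset.sum_congr rfl fun x _ => by field_simp
          rw [this]; ring
      _ ≤ _ := by
          gcongr
          exact Real.add_one_le_exp _
  have h2 := Real.log_le_log (sum_exp_pos (mwUpdate η w f)) h1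
  rw [Real.log_mul hZ.ne' (Real.exp_pos _).ne', Real.log_exp] at h2
  have h3 : ∑ x, c x * mwUpdate η w f x = ∑ x, c x * w x + η * queryMean c f := by
    unfold mwUpdate queryMean
    rw [Finset.mul_sum, ← Finset.sum_add_distrib]
    exact Finset.sum_congr rfl fun x _ => by ring
  unfold mwPotential
  rw [h3]
  linarith

end potential

section accuracy

variable {X : Type u} [Fintype X]

/-- A bound on the probability that a test is positive although the hypothesis is less than
`3 / 4 * τ` off. -/
noncomputable def falsePositiveRate (κ τ : ℝ) : ℝ := 2 * Real.exp (-(κ * τ / 4))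

theorem falsePositiveRate_pos (κ τ : ℝ) : 0 < falsePositiveRate κ τ := by
  unfold falsePositiveRate; positivity

/-- An exponential supermartingale that bounds the probability that the updates run out: `r` of
them are left, and at most `k` rounds follow. An update caused by an error of size at least
`3 / 4 * τ` does not increase the exponential factor, and an update caused by a smaller error,
although it may increase it, is sufficiently improbable; the remaining drift of a factor
`1 + falsePositiveRate κ τ` for each test is compensated by the power, since at most two tests are
made for each update and each round. -/
noncomputable def pmwSupermartingale (κ τ : ℝ) (c : X → ℝ) (k r : ℕ) (w : X → ℝ) : ℝ :=
  Real.exp (κ / 2 * (2 / τ * mwPotential c w - r * (τ / 4))) *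
    (1 + falsePositiveRate κ τ) ^ (2 * (r + k))

/-- The expected growth caused by one test. In the second case, half of the exponential decay of
`testProb` pays for the growth of the potential. -/
theorem testProb_mul_exp_le {κ τ z x : ℝ} (hκ : 0 ≤ κ) (hz : 0 ≤ z) :
    testProb (κ * (x - τ - z)) * Real.exp (κ / 2 * (3 / 4 * τ - x)) ≤
      testProb (κ * (x - τ - z)) + falsePositiveRate κ τ := by
  have hp := testProb_pos (κ * (x - τ - z))
  have hq := falsePositiveRate_pos κ τ
  rcases le_total (3 / 4 * τ) x with h | h
  · have : Real.exp (κ / 2 * (3 / 4 * τ - x)) ≤ 1 :=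
      Real.exp_le_one_iff.2 (mul_nonpos_of_nonneg_of_nonpos (by linarith) (by linarith))
    nlinarith
  · have h1 : testProb (κ * (x - τ - z)) * Real.exp (κ / 2 * (3 / 4 * τ - x)) ≤
        falsePositiveRate κ τ := by
      calc _ ≤ 2 * Real.exp (κ * (x - τ - z)) * Real.exp (κ / 2 * (3 / 4 * τ - x)) := by
            gcongr; exact testProb_le_exp _
        _ = 2 * Real.exp (κ * (x - τ - z) + κ / 2 * (3 / 4 * τ - x)) := by
            rw [Real.exp_add]; ring
        _ ≤ falsePositiveRate κ τ := by
            unfold falsePositiveRate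
            gcongr
            have h2 : 0 ≤ κ * (3 / 4 * τ - x) := mul_nonneg hκ (by linarith)
            have h3 : 0 ≤ κ * z := mul_nonneg hκ hz
            nlinarith
    linarith

theorem testProb_mul_pmwSupermartingale_le [Nonempty X] {κ τ z sgn : ℝ} (hκ : 0 ≤ κ) (hτ : 0 < τ)
    (hτ1 : τ ≤ 2) (hz : 0 ≤ z) (hs : sgn ^ 2 = 1) (c w : X → ℝ) (f : LinearQuery X) (k r : ℕ) :
    testProb (testExponent κ τ sgn c z w f) *
        pmwSupermartingale κ τ c (k + 1) r (mwUpdate (sgn * (τ / 2)) w f) ≤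
      (testProb (testExponent κ τ sgn c z w f) + falsePositiveRate κ τ) *
        pmwSupermartingale κ τ c k (r + 1) w := by
  set x := sgn * (queryMean c f - queryMean (softmax w) f) with hx
  have h1 : testExponent κ τ sgn c z w f = κ * (x - τ - z) := rfl
  have hsa : |sgn| = 1 := by
    rw [← abs_one, ← sq_eq_sq_iff_abs_eq_abs, hs, one_pow]
  have hη : |sgn * (τ / 2)| ≤ 1 := by
    rw [abs_mul, hsa, abs_of_pos (by positivity)]; linarith
  have h2 := mwPotential_update_le hη c w f
  have h3 : 2 / τ * mwPotential c (mwUpdate (sgn * (τ / 2)) w f) ≤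
      2 / τ * mwPotential c w - x + τ / 2 := by
    calc _ ≤ 2 / τ * (mwPotential c w -
          sgn * (τ / 2) * (queryMean c f - queryMean (softmax w) f) + (sgn * (τ / 2)) ^ 2) := by
          gcongr
      _ = 2 / τ * mwPotential c w - x + τ / 2 := by
          rw [mul_pow, hs, hx]; field_simp
  have h4 : pmwSupermartingale κ τ c (k + 1) r (mwUpdate (sgn * (τ / 2)) w f) ≤
      Real.exp (κ / 2 * (3 / 4 * τ - x)) * pmwSupermartingale κ τ c k (r + 1) w := by
    unfold pmwSupermartingale
    have hpow : 2 * (r + (k + 1)) = 2 * (r + 1 + k) := by ring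
    rw [hpow, ← mul_assoc, ← Real.exp_add]
    have hq := falsePositiveRate_pos κ τ
    gcongr
    rw [← mul_add]
    refine mul_le_mul_of_nonneg_left ?_ (by linarith)
    push_cast
    linarith
  have h5 : 0 ≤ pmwSupermartingale κ τ c k (r + 1) w := by
    have hq := falsePositiveRate_pos κ τ
    unfold pmwSupermartingale; positivity
  rw [h1]
  calc _ ≤ testProb (κ * (x - τ - z)) *
        (Real.exp (κ / 2 * (3 / 4 * τ - x)) * pmwSupermartingale κ τ c k (r + 1) w) := by
        gcongr; exact (testProb_pos _).le
    _ = (testProb (κ * (x - τ - z)) * Real.exp (κ / 2 * (3 / 4 * τ - x))) *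
        pmwSupermartingale κ τ c k (r + 1) w := by ring
    _ ≤ _ := by
        gcongr; exact testProb_mul_exp_le hκ hz

theorem pmwSupermartingale_nonneg (κ τ : ℝ) (c : X → ℝ) (k r : ℕ) (w : X → ℝ) :
    0 ≤ pmwSupermartingale κ τ c k r w := by
  have hq := falsePositiveRate_pos κ τ
  unfold pmwSupermartingale; positivity

/-- If both tests are negative with positive probability, then the answer is accurate. -/
theorem abs_pmwAnswer_sub_le {κ τ z α : ℝ} (hκ : 0 < κ) {o : (X → ℝ) × ℝ} (ho : 0 ≤ o.2)
    (hα : o.2 * (τ + z) ≤ α) (c w : X → ℝ) (f : LinearQuery X)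
    (h1 : testProb (testExponent κ τ 1 c z w f) ≠ 1)
    (h2 : testProb (testExponent κ τ (-1) c z w f) ≠ 1) :
    |pmwAnswer o w f - (queryMean o.1 f + o.2 * queryMean c f)| ≤ α := by
  have aux : ∀ sgn, testProb (testExponent κ τ sgn c z w f) ≠ 1 →
      sgn * (queryMean c f - queryMean (softmax w) f) ≤ τ + z := by
    intro sgn h
    by_contra hcon
    push Not at hcon
    exact h (testProb_of_nonneg (mul_nonneg hκ.le (by linarith)))
  have e : pmwAnswer o w f - (queryMean o.1 f + o.2 * queryMean c f) =
      o.2 * (queryMean (softmax w) f - queryMean c f) := by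
    unfold pmwAnswer; ring
  rw [e, abs_mul, abs_of_nonneg ho]
  refine le_trans ?_ hα
  gcongr
  rw [abs_le]
  constructor
  · linarith [aux 1 h1]
  · linarith [aux (-1) h2]

/-- The supermartingale property in one round: a functional of the answer and the next state that
is dominated by `pmwSupermartingale` whenever the answer is accurate or the updates have run out
has an expectation that is so dominated one round earlier. -/
theorem lintegral_pmwRound_le [Nonempty X] {κ τ z α : ℝ} (hκ : 0 < κ) (hτ : 0 < τ) (hτ1 : τ ≤ 2)
    (hz : 0 ≤ z) {o : (X → ℝ) × ℝ} (ho : 0 ≤ o.2) (hα : o.2 * (τ + z) ≤ α) (c : X → ℝ)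
    (f : LinearQuery X) (k r : ℕ) (w : X → ℝ) {φ : ℝ × PMWState X → ℝ≥0∞}
    (hφ : ∀ r' ≤ r, ∀ w', (r' = 0 ∨
        |pmwAnswer o w' f - (queryMean o.1 f + o.2 * queryMean c f)| ≤ α) →
      φ (pmwAnswer o w' f, (o, c, z, r', w')) ≤
        ENNReal.ofReal (pmwSupermartingale κ τ c k r' w')) :
    ∫⁻ a, φ a ∂(pmwRound κ τ o c z f r w) ≤
      ENNReal.ofReal (pmwSupermartingale κ τ c (k + 1) r w) := by
  have hq := falsePositiveRate_pos κ τ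
  induction r generalizing w with
  | zero =>
    rw [pmwRound, lintegral_dirac]
    refine (hφ 0 le_rfl w (Or.inl rfl)).trans (ENNReal.ofReal_le_ofReal ?_)
    unfold pmwSupermartingale
    gcongr
    · linarith
    · omega
  | succ r ih =>
    have ih' := fun w => ih w fun r' hr' => hφ r' (hr'.trans r.le_succ)
    have t1 := testProb_mul_pmwSupermartingale_le hκ.le hτ hτ1 hz (sgn := 1) (by norm_num)
      c w f k r
    have t2 := testProb_mul_pmwSupermartingale_le hκ.le hτ hτ1 hz (sgn := -1) (by norm_num)
      c w f k r
    rw [one_mul] at t1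
    rw [neg_one_mul] at t2
    have hY := pmwSupermartingale_nonneg κ τ c k (r + 1) w
    have hYY : pmwSupermartingale κ τ c (k + 1) (r + 1) w =
        pmwSupermartingale κ τ c k (r + 1) w * (1 + falsePositiveRate κ τ) ^ 2 := by
      unfold pmwSupermartingale
      rw [mul_assoc, ← pow_add]; ring_nf
    have p1 := (testProb_pos (testExponent κ τ 1 c z w f)).le
    have p2 := (testProb_pos (testExponent κ τ (-1) c z w f)).le
    have p1' := testProb_le_one (testExponent κ τ 1 c z w f)
    have p2' := testProb_le_one (testExponent κ τ (-1) c z w f)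
    have hdirac : ENNReal.ofReal (1 - testProb (testExponent κ τ 1 c z w f)) *
          (ENNReal.ofReal (1 - testProb (testExponent κ τ (-1) c z w f)) *
            φ (pmwAnswer o w f, (o, c, z, r + 1, w))) ≤
        ENNReal.ofReal (1 - testProb (testExponent κ τ 1 c z w f)) *
          (ENNReal.ofReal (1 - testProb (testExponent κ τ (-1) c z w f)) *
            ENNReal.ofReal (pmwSupermartingale κ τ c k (r + 1) w)) := by
      by_cases h1 : testProb (testExponent κ τ 1 c z w f) = 1
      · simp [h1]
      by_cases h2 : testProb (testExponent κ τ (-1) c z w f) = 1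
      · simp [h2]
      gcongr
      exact hφ _ le_rfl w (Or.inr (abs_pmwAnswer_sub_le hκ ho hα c w f h1 h2))
    rw [pmwRound, lintegral_add_measure, lintegral_smul_measure, lintegral_smul_measure,
      lintegral_add_measure, lintegral_smul_measure, lintegral_smul_measure, lintegral_dirac]
    simp only [smul_eq_mul]
    generalize testProb (testExponent κ τ 1 c z w f) = a₁ at *
    generalize testProb (testExponent κ τ (-1) c z w f) = a₂ at *
    generalize pmwSupermartingale κ τ c k (r + 1) w = Y at *
    generalize falsePositiveRate κ τ = q at *
    have i1 := ih' (mwUpdate (τ / 2) w f)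
    have i2 := ih' (mwUpdate (-(τ / 2)) w f)
    have W1 := pmwSupermartingale_nonneg κ τ c (k + 1) r (mwUpdate (τ / 2) w f)
    have W2 := pmwSupermartingale_nonneg κ τ c (k + 1) r (mwUpdate (-(τ / 2)) w f)
    generalize pmwSupermartingale κ τ c (k + 1) r (mwUpdate (τ / 2) w f) = V₁ at *
    generalize pmwSupermartingale κ τ c (k + 1) r (mwUpdate (-(τ / 2)) w f) = V₂ at *
    have h1' : 0 ≤ 1 - a₁ := by linarith
    have h2' : 0 ≤ 1 - a₂ := by linarith
    rw [mul_add]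
    calc _ ≤ ENNReal.ofReal a₁ * ENNReal.ofReal V₁ +
          (ENNReal.ofReal (1 - a₁) * (ENNReal.ofReal a₂ * ENNReal.ofReal V₂) +
            ENNReal.ofReal (1 - a₁) * (ENNReal.ofReal (1 - a₂) * ENNReal.ofReal Y)) := by
          gcongr
      _ = ENNReal.ofReal (a₁ * V₁ + ((1 - a₁) * (a₂ * V₂) + (1 - a₁) * ((1 - a₂) * Y))) := by
          rw [← ENNReal.ofReal_mul p1, ← ENNReal.ofReal_mul p2, ← ENNReal.ofReal_mul h1',
            ← ENNReal.ofReal_mul h2', ← ENNReal.ofReal_mul h1', ← ENNReal.ofReal_add,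
            ← ENNReal.ofReal_add] <;> positivity
      _ ≤ _ := by
          refine ENNReal.ofReal_le_ofReal ?_
          rw [hYY]
          have hle : (1 - a₁) * (a₂ * V₂) ≤ (1 - a₁) * ((a₂ + q) * Y) :=
            mul_le_mul_of_nonneg_left t2 h1'
          have e1 : 0 ≤ a₁ * q * Y := by positivity
          have e2 : 0 ≤ q ^ 2 * Y := by positivity
          nlinarith

end accuracy

/-! ### Accuracy of private multiplicative weights -/

section transcriptAccuracy

variable {X : Type u} {n : ℕ}

/-- The transcripts with an answer that is off by more than `α`. -/
def inaccurateSet (S : Fin n → X) (m : ℕ) (α : ℝ) : Set (Transcript X m) :=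
  {t | ∀ i, |(t i).2 - empiricalMean S (t i).1| ≤ α}ᶜ

theorem measurable_empiricalMean (S : Fin n → X) :
    Measurable fun f : LinearQuery X => empiricalMean S f := by
  unfold empiricalMean; fun_prop

theorem measurableSet_inaccurateSet (S : Fin n → X) (m : ℕ) (α : ℝ) :
    MeasurableSet (inaccurateSet S m α) := by
  refine MeasurableSet.compl ?_
  rw [Set.ofPred_forall]
  refine MeasurableSet.iInter fun i => measurableSet_le ?_ measurable_const
  have h1 : Measurable fun t : Transcript X m => empiricalMean S (t i).1 :=
    (measurable_empiricalMean S).comp (by fun_prop)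
  have h2 : Measurable fun t : Transcript X m => (t i).2 - empiricalMean S (t i).1 :=
    Measurable.sub (by fun_prop) h1
  exact h2.abs

theorem InteractiveMechanism.isAccurate_of_inaccurateSet_le (M : InteractiveMechanism X n)
    {m : ℕ} {α β : ℝ} (hβ : 0 ≤ β)
    (h : ∀ (B : QueryAdversary X) (S : Fin n → X),
      M.transcriptLaw B S m (inaccurateSet S m α) ≤ ENNReal.ofReal β) :
    M.IsAccurate m α β := by
  intro B S
  have h1 := prob_compl_eq_one_sub (μ := M.transcriptLaw B S m)
    (measurableSet_inaccurateSet S m α)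
  rw [inaccurateSet, compl_compl] at h1
  rw [h1, ENNReal.ofReal_sub _ hβ, ENNReal.ofReal_one]
  exact tsub_le_tsub_left (h B S) _

theorem mem_inaccurateSet_snoc {S : Fin n → X} {m : ℕ} {α : ℝ} {t : Transcript X m}
    {a : LinearQuery X × ℝ} (ht : t ∉ inaccurateSet S m α)
    (ha : |a.2 - empiricalMean S a.1| ≤ α) :
    (Fin.snoc t a : Transcript X (m + 1)) ∉ inaccurateSet S (m + 1) α := by
  simp only [inaccurateSet, Set.mem_compl_iff, Set.mem_ofPred_eq, not_not] at ht ⊢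
  intro i
  induction i using Fin.lastCases with
  | last => simpa using ha
  | cast i => simpa using ht i

theorem elim0_notMem_inaccurateSet (S : Fin n → X) (α : ℝ) :
    (Fin.elim0 : Transcript X 0) ∉ inaccurateSet S 0 α := by
  simp [inaccurateSet]

variable [Fintype X]

/-- Answers that are given without any updates are accurate if the initial hypothesis is. -/
theorem pmw_value_inaccurateSet_eq_zero (κ τ : ℝ) (T : ℕ) {θ : ℝ} (hθ : 0 < θ) {ι : Type}
    [Fintype ι] (Q : ι → Finset (Fin n)) (q : ι → ℝ≥0∞) (hq : ∑ i, q i = 1)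
    (B : QueryAdversary X) (S : Fin n → X) (m : ℕ) {α : ℝ} (o : (X → ℝ) × ℝ) (c : X → ℝ) (z : ℝ)
    (h : ∀ f, |pmwAnswer o 0 f - empiricalMean S f| ≤ α) :
    (pmwMechanism κ τ T hθ Q q hq).value B m (fun p => (inaccurateSet S m α).indicator 1 p.1)
      (o, c, z, 0, 0) = 0 := by
  classical
  -- `G` is `⊤` outside an invariant of the interaction, so that the invariant holds almost surely
  let G : (i : ℕ) → Transcript X i × PMWState X → ℝ≥0∞ := fun i p =>
    if p.2 = (o, c, z, 0, 0) ∧ p.1 ∉ inaccurateSet S i α then 0 else ⊤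
  have hG0 : G 0 (Fin.elim0, (o, c, z, 0, 0)) = 0 :=
    if_pos ⟨rfl, elim0_notMem_inaccurateSet S α⟩
  rw [← nonpos_iff_eq_zero, ← hG0]
  refine le_trans ((pmwMechanism κ τ T hθ Q q hq).value_mono B (ψ := G m) ?_ _)
    ((pmwMechanism κ τ T hθ Q q hq).value_le_of_supermartingale B G ?_ _)
  · rintro ⟨t, s⟩
    by_cases ht : t ∈ inaccurateSet S m α <;> simp [G, ht]
  · rintro i - ⟨t, s⟩
    by_cases hs : s = (o, c, z, 0, 0) ∧ t ∉ inaccurateSet S i α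
    · obtain ⟨rfl, ht⟩ := hs
      have : G i (t, (o, c, z, 0, 0)) = 0 := if_pos ⟨rfl, ht⟩
      rw [this, nonpos_iff_eq_zero]
      refine lintegral_eq_zero_of_ae_eq_zero (Filter.Eventually.of_forall fun f => ?_)
      change ∫⁻ a, G (i + 1) (Fin.snoc t (f, a.1), a.2) ∂(pmwRound κ τ o c z f 0 0) = 0
      rw [pmwRound, lintegral_dirac]
      exact if_pos ⟨rfl, mem_inaccurateSet_snoc ht (h f)⟩
    · have : G i (t, s) = ⊤ := if_neg hs
      rw [this]; exact le_top

/-- The probability of an inaccurate answer, given the noise `z` of the threshold. -/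
theorem pmw_value_inaccurateSet_le [Nonempty X] {κ τ z α : ℝ} (hκ : 0 < κ) (hτ : 0 < τ)
    (hτ1 : τ ≤ 2) (hz : 0 ≤ z) (T T' : ℕ) {θ : ℝ} (hθ : 0 < θ) {ι : Type} [Fintype ι]
    (Q : ι → Finset (Fin n)) (q : ι → ℝ≥0∞) (hq : ∑ i, q i = 1) (B : QueryAdversary X)
    (S : Fin n → X) (m : ℕ) {o : (X → ℝ) × ℝ} {c : X → ℝ} (hc0 : ∀ x, 0 ≤ c x)
    (hc1 : ∑ x, c x = 1) (ho : 0 ≤ o.2) (hα : o.2 * (τ + z) ≤ α)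
    (hS : ∀ f, queryMean o.1 f + o.2 * queryMean c f = empiricalMean S f) :
    (pmwMechanism κ τ T' hθ Q q hq).value B m (fun p => (inaccurateSet S m α).indicator 1 p.1)
      (o, c, z, T, 0) ≤ ENNReal.ofReal (pmwSupermartingale κ τ c m T 0) := by
  classical
  -- the value `⊤` enforces the invariant that the data and the threshold do not change, and that
  -- all answers are accurate unless the updates have run out
  let G : (i : ℕ) → Transcript X i × PMWState X → ℝ≥0∞ := fun i p =>
    if (p.2.1 = o ∧ p.2.2.1 = c ∧ p.2.2.2.1 = z) ∧
        (p.2.2.2.2.1 = 0 ∨ p.1 ∉ inaccurateSet S i α) then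
      ENNReal.ofReal (pmwSupermartingale κ τ c (m - i) p.2.2.2.2.1 p.2.2.2.2.2) else ⊤
  have hG0 : G 0 (Fin.elim0, (o, c, z, T, 0)) =
      ENNReal.ofReal (pmwSupermartingale κ τ c m T 0) :=
    if_pos ⟨⟨rfl, rfl, rfl⟩, Or.inr (elim0_notMem_inaccurateSet S α)⟩
  rw [← hG0]
  refine le_trans ((pmwMechanism κ τ T' hθ Q q hq).value_mono B (ψ := G m) ?_ _)
    ((pmwMechanism κ τ T' hθ Q q hq).value_le_of_supermartingale B G ?_ _)
  · rintro ⟨t, o', c', z', r, w⟩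
    by_cases ht : t ∈ inaccurateSet S m α
    swap
    · simp [ht]
    by_cases hs : (o' = o ∧ c' = c ∧ z' = z) ∧ r = 0
    · obtain ⟨⟨rfl, rfl, rfl⟩, rfl⟩ := hs
      have : G m (t, (o', c', z', 0, w)) =
          ENNReal.ofReal (pmwSupermartingale κ τ c' (m - m) 0 w) :=
        if_pos ⟨⟨rfl, rfl, rfl⟩, Or.inl rfl⟩
      rw [this]
      simp only [ht, Set.indicator_of_mem, Pi.one_apply, ENNReal.one_le_ofReal]
      have h0 := mwPotential_nonneg hc0 hc1 w
      simp only [pmwSupermartingale, Nat.sub_self, add_zero, mul_zero, pow_zero, mul_one,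
        Nat.cast_zero, zero_mul, sub_zero]
      exact Real.one_le_exp (by positivity)
    · have : G m (t, (o', c', z', r, w)) = ⊤ := if_neg fun h => by
        rcases h with ⟨h1, h2 | h2⟩
        · exact hs ⟨h1, h2⟩
        · exact h2 ht
      rw [this]; exact le_top
  · rintro i hi ⟨t, o', c', z', r, w⟩
    by_cases hs : (o' = o ∧ c' = c ∧ z' = z) ∧ (r = 0 ∨ t ∉ inaccurateSet S i α)
    · obtain ⟨⟨rfl, rfl, rfl⟩, hr⟩ := hs
      have hGi : G i (t, (o', c', z', r, w)) =
          ENNReal.ofReal (pmwSupermartingale κ τ c' (m - i) r w) :=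
        if_pos ⟨⟨rfl, rfl, rfl⟩, hr⟩
      have hk : m - i = (m - (i + 1)) + 1 := by omega
      have hround : ∀ f, ∫⁻ a, G (i + 1) (Fin.snoc t (f, a.1), a.2)
          ∂(pmwRound κ τ o' c' z' f r w) ≤
          ENNReal.ofReal (pmwSupermartingale κ τ c' (m - i) r w) := by
        intro f
        rw [hk]
        refine lintegral_pmwRound_le hκ hτ hτ1 hz ho hα c' f _ r w fun r' hr' w' hacc => ?_
        refine le_of_eq (if_pos ⟨⟨rfl, rfl, rfl⟩, ?_⟩)
        rcases hacc with h | h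
        · exact Or.inl h
        rcases hr with h0 | h0
        · exact Or.inl (Nat.le_zero.1 (h0 ▸ hr'))
        · exact Or.inr (mem_inaccurateSet_snoc h0 (by rw [← hS f]; exact h))
      rw [hGi]
      refine (lintegral_mono hround).trans ?_
      simp
    · have : G i (t, (o', c', z', r, w)) = ⊤ := if_neg hs
      rw [this]; exact le_top

end transcriptAccuracy

section blockAccuracy

variable {X : Type u} {n : ℕ}

theorem blockHistogram_nonneg (Q : Finset (Fin n)) (S : Fin n → X) (x : X) :
    0 ≤ blockHistogram Q S x := by
  unfold blockHistogram
  exact Finset.sum_nonneg fun j _ => by split_ifs <;> norm_num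

variable [Fintype X]

theorem sum_blockHistogram_div {Q : Finset (Fin n)} (hQ : Q.Nonempty) (S : Fin n → X) :
    ∑ x, blockHistogram Q S x / (Q.card : ℝ) = 1 := by
  have h := queryMean_blockHistogram Q S (Q.card : ℝ) (fun _ => 1)
  have hc : (Q.card : ℝ) ≠ 0 := by exact_mod_cast hQ.card_pos.ne'
  simpa [queryMean, hc] using h

/-- The public and the private part add up to the dataset. -/
theorem queryMean_add_block (Q : Finset (Fin n)) (S : Fin n → X) (f : LinearQuery X) :
    queryMean (fun x => blockHistogram Qᶜ S x / n) f +
      (Q.card : ℝ) / n * queryMean (fun x => blockHistogram Q S x / Q.card) f =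
    empiricalMean S f := by
  rw [queryMean_blockHistogram, queryMean_blockHistogram, empiricalMean,
    ← Finset.sum_add_sum_compl Q]
  rcases Q.eq_empty_or_nonempty with rfl | hQ
  · simp
  · have hc : (Q.card : ℝ) ≠ 0 := by exact_mod_cast hQ.card_pos.ne'
    field_simp
    ring

theorem abs_pmwAnswer_start_sub_le [Nonempty X] (Q : Finset (Fin n)) (S : Fin n → X)
    (f : LinearQuery X) :
    |pmwAnswer (fun x => blockHistogram Qᶜ S x / n, (Q.card : ℝ) / n) 0 f - empiricalMean S f| ≤
      (Q.card : ℝ) / n := by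
  rw [← queryMean_add_block Q S f]
  rcases Q.eq_empty_or_nonempty with rfl | hQ
  · simp [pmwAnswer]
  have h1 := queryMean_mem_Icc (softmax_nonneg 0) (sum_softmax (X := X) 0) f
  have h2 := queryMean_mem_Icc (fun x => div_nonneg (blockHistogram_nonneg Q S x)
    (Nat.cast_nonneg Q.card)) (sum_blockHistogram_div hQ S) f
  have e : pmwAnswer (fun x => blockHistogram Qᶜ S x / n, (Q.card : ℝ) / n) 0 f -
      (queryMean (fun x => blockHistogram Qᶜ S x / n) f +
        (Q.card : ℝ) / n * queryMean (fun x => blockHistogram Q S x / Q.card) f) =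
      (Q.card : ℝ) / n * (queryMean (softmax 0) f -
        queryMean (fun x => blockHistogram Q S x / Q.card) f) := by
    unfold pmwAnswer; ring
  rw [e, abs_mul, abs_of_nonneg (by positivity : 0 ≤ (Q.card : ℝ) / n)]
  refine mul_le_of_le_one_right (by positivity) ?_
  rw [abs_le]
  constructor <;> linarith [h1.1, h1.2, h2.1, h2.2]

/-- Accuracy for a fixed private part, when no updates are made. -/
theorem lintegral_value_inaccurateSet_eq_zero [Nonempty X] (κ τ : ℝ) {θ : ℝ} (hθ : 0 < θ)
    {ι : Type} [Fintype ι] (Q : ι → Finset (Fin n)) (q : ι → ℝ≥0∞) (hq : ∑ i, q i = 1)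
    (B : QueryAdversary X) (S : Fin n → X) (m : ℕ) {α : ℝ} (i : ι)
    (hα : ((Q i).card : ℝ) / n ≤ α) :
    ∫⁻ z, (pmwMechanism κ τ 0 hθ Q q hq).value B m
      (fun p => (inaccurateSet S m α).indicator 1 p.1) (pmwStart 0 (Q i) S z) ∂(expMeasure θ) =
      0 := by
  refine lintegral_eq_zero_of_ae_eq_zero (Filter.Eventually.of_forall fun z => ?_)
  exact pmw_value_inaccurateSet_eq_zero κ τ 0 hθ Q q hq B S m _ _ z
    fun f => (abs_pmwAnswer_start_sub_le (Q i) S f).trans hα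

/-- Accuracy for a fixed private part: the noise `z` of the threshold is at most `Z` with high
probability, and then an inaccurate answer is given only after the updates have run out. -/
theorem lintegral_value_inaccurateSet_le [Nonempty X] {κ τ θ Z α β : ℝ} (hκ : 0 < κ) (hτ : 0 < τ)
    (hτ1 : τ ≤ 2) (hθ : 0 < θ) (hZ : 0 ≤ Z) (T : ℕ) {ι : Type} [Fintype ι]
    (Q : ι → Finset (Fin n)) (q : ι → ℝ≥0∞) (hq : ∑ i, q i = 1) (B : QueryAdversary X)
    (S : Fin n → X) (m : ℕ) (i : ι) (hQ : (Q i).Nonempty)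
    (hα : ((Q i).card : ℝ) / n * (τ + Z) ≤ α) (hβ : Real.exp (-(θ * Z)) ≤ β / 2)
    (hT : ∀ c : X → ℝ, pmwSupermartingale κ τ c m T 0 ≤ β / 2) :
    ∫⁻ z, (pmwMechanism κ τ T hθ Q q hq).value B m
      (fun p => (inaccurateSet S m α).indicator 1 p.1) (pmwStart T (Q i) S z) ∂(expMeasure θ) ≤
      ENNReal.ofReal β := by
  have := isProbabilityMeasure_expMeasure hθ
  have hβ0 : 0 ≤ β / 2 := (Real.exp_pos _).le.trans hβ
  have hpt : ∀ z, 0 ≤ z → (pmwMechanism κ τ T hθ Q q hq).value B m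
      (fun p => (inaccurateSet S m α).indicator 1 p.1) (pmwStart T (Q i) S z) ≤
      ENNReal.ofReal (β / 2) + (Set.Ioi Z).indicator 1 z := by
    intro z hz
    rcases lt_or_ge Z z with h | h
    · refine (InteractiveMechanism.value_indicator_le_one _ B _ _).trans ?_
      rw [Set.indicator_of_mem (show z ∈ Set.Ioi Z from h)]
      exact le_add_of_nonneg_left zero_le
    · refine le_trans ?_ (le_add_of_nonneg_right zero_le)
      refine (pmw_value_inaccurateSet_le hκ hτ hτ1 hz T T hθ Q q hq B S m
        (o := (fun x => blockHistogram (Q i)ᶜ S x / n, ((Q i).card : ℝ) / n))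
        (fun x => div_nonneg (blockHistogram_nonneg (Q i) S x) (Nat.cast_nonneg _))
        (sum_blockHistogram_div hQ S) (by positivity) (le_trans ?_ hα)
        (queryMean_add_block (Q i) S)).trans (ENNReal.ofReal_le_ofReal (hT _))
      gcongr
  calc _ ≤ ∫⁻ z, (ENNReal.ofReal (β / 2) + (Set.Ioi Z).indicator 1 z) ∂(expMeasure θ) :=
        lintegral_mono_ae ((ae_nonneg_expMeasure θ).mono hpt)
    _ = ENNReal.ofReal (β / 2) + ENNReal.ofReal (Real.exp (-(θ * Z))) := by
        rw [lintegral_add_left measurable_const, lintegral_indicator_one measurableSet_Ioi,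
          expMeasure_Ioi hθ hZ]
        simp
    _ ≤ ENNReal.ofReal (β / 2) + ENNReal.ofReal (β / 2) := by gcongr
    _ = ENNReal.ofReal β := by rw [← ENNReal.ofReal_add hβ0 hβ0, add_halves]

theorem pmwMechanism_isAccurate (κ τ : ℝ) (T : ℕ) {θ : ℝ} (hθ : 0 < θ) {ι : Type} [Fintype ι]
    (Q : ι → Finset (Fin n)) (q : ι → ℝ≥0∞) (hq : ∑ i, q i = 1) {m : ℕ} {α β : ℝ} (hβ : 0 ≤ β)
    (b : ι → ℝ≥0∞) (hb : ∑ i, q i * b i ≤ ENNReal.ofReal β)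
    (h : ∀ (B : QueryAdversary X) (S : Fin n → X) (i : ι),
      ∫⁻ z, (pmwMechanism κ τ T hθ Q q hq).value B m
        (fun p => (inaccurateSet S m α).indicator 1 p.1) (pmwStart T (Q i) S z) ∂(expMeasure θ) ≤
        b i) :
    (pmwMechanism (X := X) κ τ T hθ Q q hq).IsAccurate m α β := by
  refine InteractiveMechanism.isAccurate_of_inaccurateSet_le _ hβ fun B S => ?_
  rw [pmwMechanism_transcriptLaw κ τ T hθ Q q hq B S (measurableSet_inaccurateSet S m α)]
  refine le_trans (Finset.sum_le_sum fun i _ => ?_) hb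
  gcongr
  exact h B S i

end blockAccuracy

/-! ### The Laplace mechanism for a single query -/

section laplace

/-- The Laplace distribution of rate `θ`, as exponential noise with a random sign. -/
noncomputable def laplaceMeasure (θ : ℝ) : Measure ℝ :=
  (2⁻¹ : ℝ≥0∞) • expMeasure θ + (2⁻¹ : ℝ≥0∞) • (expMeasure θ).map Neg.neg

theorem isProbabilityMeasure_laplaceMeasure {θ : ℝ} (hθ : 0 < θ) :
    IsProbabilityMeasure (laplaceMeasure θ) := by
  have := isProbabilityMeasure_expMeasure hθ
  have := Measure.isProbabilityMeasure_map (μ := expMeasure θ) (measurable_neg.aemeasurable)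
  exact ⟨by simp [laplaceMeasure, ENNReal.inv_two_add_inv_two]⟩

theorem lintegral_laplaceMeasure (θ : ℝ) {g : ℝ → ℝ≥0∞} (hg : Measurable g) :
    ∫⁻ x, g x ∂(laplaceMeasure θ) =
      2⁻¹ * ∫⁻ x, (exponentialPDF θ x + exponentialPDF θ (-x)) * g x := by
  have hm : Measurable (exponentialPDF θ) := (measurable_exponentialPDFReal θ).ennreal_ofReal
  have hg' : Measurable fun x => g (-x) := hg.comp measurable_neg
  have hm1 : Measurable fun x => exponentialPDF θ x * g x := hm.mul hg
  rw [laplaceMeasure, lintegral_add_measure, lintegral_smul_measure, lintegral_smul_measure,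
    lintegral_map hg measurable_neg, lintegral_expMeasure θ hg, lintegral_expMeasure θ hg',
    smul_eq_mul, smul_eq_mul, ← mul_add,
    ← lintegral_neg_eq_self (fun x => exponentialPDF θ x * g (-x)),
    ← lintegral_add_left hm1]
  simp only [neg_neg, add_mul]

theorem exponentialPDF_add_neg_of_ne {θ x : ℝ} (hx : x ≠ 0) :
    exponentialPDF θ x + exponentialPDF θ (-x) = ENNReal.ofReal (θ * Real.exp (-(θ * |x|))) := by
  rcases lt_or_gt_of_ne hx with h | h
  · rw [exponentialPDF_of_neg h, exponentialPDF_of_nonneg (by linarith), zero_add, abs_of_neg h]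
  · rw [exponentialPDF_of_nonneg h.le, exponentialPDF_of_neg (by linarith), add_zero, abs_of_pos h]

theorem le_exponentialPDF_add_neg (θ x : ℝ) :
    ENNReal.ofReal (θ * Real.exp (-(θ * |x|))) ≤
      exponentialPDF θ x + exponentialPDF θ (-x) := by
  rcases eq_or_ne x 0 with rfl | h
  · rw [exponentialPDF_of_nonneg le_rfl, abs_zero]
    exact le_add_of_nonneg_right zero_le
  · exact (exponentialPDF_add_neg_of_ne h).ge

/-- A translation of Laplace noise by `s` costs a factor `exp (θ * |s|)`. -/
theorem lintegral_laplaceMeasure_shift_le {θ s ε : ℝ} (hθ : 0 < θ) (hs : θ * |s| ≤ ε)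
    {g : ℝ → ℝ≥0∞} (hg : Measurable g) :
    ∫⁻ x, g (x + s) ∂(laplaceMeasure θ) ≤
      ENNReal.ofReal (Real.exp ε) * ∫⁻ x, g x ∂(laplaceMeasure θ) := by
  have hg' : Measurable fun x => g (x + s) := hg.comp (by fun_prop : Measurable fun x : ℝ => x + s)
  rw [lintegral_laplaceMeasure θ hg', lintegral_laplaceMeasure θ hg, mul_left_comm]
  gcongr
  rw [← lintegral_add_right_eq_self (fun x => (exponentialPDF θ x + exponentialPDF θ (-x)) * g x) s,
    ← lintegral_const_mul' _ _ ENNReal.ofReal_ne_top]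
  -- at `0` the two one-sided densities overlap
  have hne : ∀ᵐ x : ℝ, x ≠ 0 := by simp [ae_iff]
  refine lintegral_mono_ae (hne.mono fun x hx => ?_)
  rw [exponentialPDF_add_neg_of_ne hx, ← mul_assoc]
  gcongr
  refine le_trans ?_ (mul_le_mul_right (le_exponentialPDF_add_neg θ (x + s)) _)
  rw [← ENNReal.ofReal_mul (Real.exp_pos _).le]
  refine ENNReal.ofReal_le_ofReal ?_
  rw [mul_left_comm, ← Real.exp_add]
  gcongr
  have h1 : |x + s| ≤ |x| + |s| := abs_add_le x s
  nlinarith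

theorem laplaceMeasure_abs_gt_le {θ a : ℝ} (hθ : 0 < θ) (ha : 0 ≤ a) :
    laplaceMeasure θ {x | a < |x|} ≤ ENNReal.ofReal (Real.exp (-(θ * a))) := by
  have hms : MeasurableSet {x : ℝ | a < |x|} := measurableSet_lt measurable_const (by fun_prop)
  have h1 : expMeasure θ {x | a < |x|} = ENNReal.ofReal (Real.exp (-(θ * a))) := by
    rw [← expMeasure_Ioi hθ ha]
    refine measure_congr ((ae_nonneg_expMeasure θ).mono fun x hx => ?_)
    refine propext ?_
    change a < |x| ↔ a < x
    rw [abs_of_nonneg hx]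
  have h2 : Neg.neg ⁻¹' {x : ℝ | a < |x|} = {x | a < |x|} := by
    ext x; simp
  rw [laplaceMeasure, Measure.add_apply, Measure.smul_apply, Measure.smul_apply,
    Measure.map_apply measurable_neg hms, h2, h1, smul_eq_mul, ← add_mul,
    ENNReal.inv_two_add_inv_two, one_mul]

variable {X : Type u} [Fintype X] {n : ℕ}

/-- The mechanism that adds Laplace noise to the empirical mean. The noise is part of the hidden
state and is not redrawn, so that this is private for a single query only. -/
noncomputable abbrev laplaceMechanism (X : Type u) [Fintype X] (n : ℕ) {θ : ℝ} (hθ : 0 < θ) :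
    InteractiveMechanism X n where
  State := (X → ℝ) × ℝ
  init S := (laplaceMeasure θ).map fun x => (fun y => blockHistogram Finset.univ S y / n, x)
  init_prob S := by
    have := isProbabilityMeasure_laplaceMeasure hθ
    exact Measure.isProbabilityMeasure_map (by fun_prop)
  answer := Kernel.deterministic
    (fun p : ((X → ℝ) × ℝ) × LinearQuery X => (queryMean p.1.1 p.2 + p.1.2, p.1)) (by
      have : Measurable fun p : ((X → ℝ) × ℝ) × LinearQuery X => queryMean p.1.1 p.2 :=
        measurable_queryMean.comp (by fun_prop :
          Measurable fun p : ((X → ℝ) × ℝ) × LinearQuery X => (p.1.1, p.2))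
      fun_prop)

theorem queryMean_univ (S : Fin n → X) (f : LinearQuery X) :
    queryMean (fun y => blockHistogram Finset.univ S y / n) f = empiricalMean S f := by
  rw [queryMean_blockHistogram, empiricalMean]

theorem laplaceMechanism_transcriptLaw {θ : ℝ} (hθ : 0 < θ) (B : QueryAdversary X)
    (S : Fin n → X) {E : Set (Transcript X 1)} (hE : MeasurableSet E) :
    (laplaceMechanism X n hθ).transcriptLaw B S 1 E =
      ∫⁻ f, ∫⁻ x, E.indicator 1 (Fin.snoc Fin.elim0 (f, empiricalMean S f + x) : Transcript X 1)
        ∂(laplaceMeasure θ) ∂(B.ask 0 Fin.elim0) := by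
  have := isProbabilityMeasure_laplaceMeasure hθ
  have hmv := (laplaceMechanism X n hθ).measurable_value B
    ((laplaceMechanism X n hθ).measurable_indicator_fst hE)
  have hsn : Measurable fun p : LinearQuery X × ℝ =>
      (Fin.snoc Fin.elim0 (p.1, empiricalMean S p.1 + p.2) : Transcript X 1) := by
    refine measurable_pi_lambda _ fun i => ?_
    have h1 : Measurable fun p : LinearQuery X × ℝ => empiricalMean S p.1 :=
      (measurable_empiricalMean S).comp measurable_fst
    induction i using Fin.lastCases with
    | last => simp only [Fin.snoc_last]; fun_prop
    | cast i => exact i.elim0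
  rw [InteractiveMechanism.transcriptLaw_apply _ _ _ hE, lintegral_map hmv (by fun_prop),
    lintegral_lintegral_swap]
  · refine lintegral_congr fun x => ?_
    change ∫⁻ f, ∫⁻ a, _ ∂_ ∂_ = _
    refine lintegral_congr fun f => ?_
    rw [Kernel.deterministic_apply, lintegral_dirac]
    simp only [queryMean_univ]
  · exact ((measurable_one.indicator hE).comp hsn).aemeasurable

theorem empiricalMean_sub_le {S S' : Fin n → X} (h : Neighboring S S') (f : LinearQuery X) :
    |empiricalMean S f - empiricalMean S' f| ≤ 1 / n := by
  obtain ⟨j, hj⟩ := h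
  have h1 := abs_queryMean_sub_le (Finset.mem_univ j) hj f
  have h2 : queryMean ((fun x => blockHistogram Finset.univ S' x /
        ((Finset.univ : Finset (Fin n)).card : ℝ)) -
      fun x => blockHistogram Finset.univ S x / ((Finset.univ : Finset (Fin n)).card : ℝ)) f =
      empiricalMean S' f - empiricalMean S f := by
    rw [← queryMean_univ, ← queryMean_univ]
    simp [queryMean, sub_mul]
  rw [h2] at h1
  rw [abs_sub_comm]
  simpa using h1

theorem laplaceMechanism_isDifferentiallyPrivate {ε δ : ℝ} (hθ : 0 < n * ε) :
    (laplaceMechanism X n hθ).IsDifferentiallyPrivate 1 ε δ := by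
  intro B S S' hS E hE
  refine le_trans ?_ (le_add_of_nonneg_right zero_le)
  rw [laplaceMechanism_transcriptLaw hθ B S hE, laplaceMechanism_transcriptLaw hθ B S' hE,
    ← lintegral_const_mul' _ _ ENNReal.ofReal_ne_top]
  refine lintegral_mono fun f => ?_
  have hsn : Measurable fun x : ℝ =>
      (Fin.snoc Fin.elim0 (f, empiricalMean S' f + x) : Transcript X 1) := by
    refine measurable_pi_lambda _ fun i => ?_
    induction i using Fin.lastCases with
    | last => simp only [Fin.snoc_last]; fun_prop
    | cast i => exact i.elim0
  have hn : (n : ℝ) ≠ 0 := fun h => by simp [h] at hθ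
  have hn0 : 0 ≤ (n : ℝ) := Nat.cast_nonneg n
  have hε : 0 ≤ ε := by
    by_contra h
    push Not at h
    nlinarith
  have hs : n * ε * |empiricalMean S f - empiricalMean S' f| ≤ ε := by
    calc _ ≤ n * ε * (1 / n) := by
          gcongr; exact empiricalMean_sub_le hS f
      _ = ε := by field_simp
  refine le_trans (le_of_eq ?_) (lintegral_laplaceMeasure_shift_le hθ hs
    ((measurable_one.indicator hE).comp hsn))
  refine lintegral_congr fun x => ?_
  have : empiricalMean S f + x =
      empiricalMean S' f + (x + (empiricalMean S f - empiricalMean S' f)) := by ring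
  rw [this]

theorem laplaceMechanism_isAccurate {θ β : ℝ} (hθ : 0 < θ) (hβ : 0 < β) (hβ1 : β < 1) :
    (laplaceMechanism X n hθ).IsAccurate 1 (Real.log (1 / β) / θ) β := by
  refine InteractiveMechanism.isAccurate_of_inaccurateSet_le _ hβ.le fun B S => ?_
  have hK : 0 ≤ Real.log (1 / β) / θ :=
    div_nonneg (Real.log_nonneg (by rw [le_div_iff₀ hβ]; linarith)) hθ.le
  rw [laplaceMechanism_transcriptLaw hθ B S (measurableSet_inaccurateSet _ _ _)]
  have hms : MeasurableSet {x : ℝ | Real.log (1 / β) / θ < |x|} :=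
    measurableSet_lt measurable_const (by fun_prop)
  have hin : ∀ f, ∫⁻ x, (inaccurateSet S 1 (Real.log (1 / β) / θ)).indicator 1
      (Fin.snoc Fin.elim0 (f, empiricalMean S f + x) : Transcript X 1) ∂(laplaceMeasure θ) ≤
      ENNReal.ofReal β := by
    intro f
    have h1 := laplaceMeasure_abs_gt_le hθ hK
    have h2 : Real.exp (-(θ * (Real.log (1 / β) / θ))) = β := by
      rw [mul_div_cancel₀ _ hθ.ne', one_div, Real.log_inv, neg_neg, Real.exp_log hβ]
    rw [h2, ← lintegral_indicator_one hms] at h1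
    refine le_trans (lintegral_mono fun x => ?_) h1
    by_cases hx : Real.log (1 / β) / θ < |x|
    · rw [Set.indicator_of_mem (show x ∈ {x : ℝ | Real.log (1 / β) / θ < |x|} from hx)]
      exact Set.indicator_le_self' (fun _ _ => zero_le) _
    · have := mem_inaccurateSet_snoc (elim0_notMem_inaccurateSet S (Real.log (1 / β) / θ))
        (a := (f, empiricalMean S f + x)) (by simpa using hx)
      rw [Set.indicator_of_notMem this]
      exact zero_le
  refine (lintegral_mono hin).trans ?_
  simp

end laplace

/-! ### Choice of the parameters -/

section parameters

/-- The scale of the composition of `T` updates with `D = log (1 / δ)`: `√(T * D)`, or `T` if this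
is less, where pure privacy is cheaper. -/
noncomputable def compositionScale (T D : ℝ) : ℝ := Real.sqrt (T * min T D)

theorem compositionScale_pos {T D : ℝ} (hT : 0 < T) (hD : 0 < D) : 0 < compositionScale T D :=
  Real.sqrt_pos.2 (mul_pos hT (lt_min hT hD))

theorem compositionScale_le {T : ℝ} (hT : 0 ≤ T) (D : ℝ) : compositionScale T D ≤ T := by
  refine Real.sqrt_le_iff.2 ⟨hT, ?_⟩
  rw [sq]
  gcongr
  exact min_le_left _ _

/-- The charge of an update that makes the total charge of `T` updates affordable: linear in the
step size if `T ≤ log (1 / δ)`, and quadratic otherwise. -/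
theorem exists_charge {ε D T : ℝ} (hε : 0 < ε) (hε1 : ε < 1) (hD : 1 / 4 ≤ D) (hT : 1 ≤ T) :
    ∃ μ : ℝ, 0 ≤ μ ∧
      (∀ v v' : ℝ, v' ≤ v → v ≤ v' + ε / (64 * compositionScale T D) →
        testProb v * (testProb v / testProb v') ^ (4 * D / ε) *
            Real.exp (-((1 + 4 * D / ε) * μ)) +
          (1 - testProb v) * ((1 - testProb v) / (1 - testProb v')) ^ (4 * D / ε) ≤ 1) ∧
      (1 + 4 * D / ε) * μ * T - 4 * D / ε * (ε / 2) ≤ -D := by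
  have hD0 : 0 < D := by linarith
  have hT0 : 0 < T := by linarith
  have hs := compositionScale_pos hT0 hD0
  set s := compositionScale T D with hsdef
  have hl0 : 0 < 4 * D / ε := by positivity
  have hl1 : 1 ≤ 4 * D / ε := by rw [le_div_iff₀ hε]; linarith
  have hl2 : 4 * D / ε * (ε / 2) = 2 * D := by field_simp; ring
  have hk : 0 ≤ ε / (64 * s) := by positivity
  have hlk : 4 * D / ε * (ε / (64 * s)) = D / (16 * s) := by field_simp; ring
  have hcancel : ∀ μ' : ℝ, (1 + 4 * D / ε) * (μ' / (1 + 4 * D / ε)) = μ' := fun μ' => by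
    field_simp
  rcases le_total T D with h | h
  · have hsT : s = T := by
      rw [hsdef, compositionScale, min_eq_left h, Real.sqrt_mul_self hT0.le]
    refine ⟨(ε / (64 * s) * (4 * D / ε)) / (1 + 4 * D / ε), by positivity, ?_, ?_⟩
    · intro v v' hv hv'
      rw [hcancel]
      exact divergence_le_one_of_linear_charge hl0.le hk hv hv'
    · rw [hcancel, hl2, mul_comm (ε / (64 * s)), hlk, hsT]
      have : D / (16 * T) * T = D / 16 := by field_simp
      rw [this]; linarith
  · have hs2 : s ^ 2 = T * D := by
      rw [hsdef, compositionScale, min_eq_right h, Real.sq_sqrt (by positivity)]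
    have hDs : D ≤ s := by
      refine le_of_sq_le_sq ?_ hs.le
      rw [hs2, sq]; gcongr
    refine ⟨(160 * (4 * D / ε * (ε / (64 * s))) ^ 2) / (1 + 4 * D / ε), by positivity, ?_, ?_⟩
    · intro v v' hv hv'
      rw [hcancel]
      refine divergence_le_one_of_quadratic_charge hl1 hk ?_ hv hv'
      rw [hlk, div_le_div_iff₀ (by positivity) (by norm_num)]
      linarith
    · rw [hcancel, hl2, hlk, div_pow, mul_pow, hs2]
      have : 160 * (D ^ 2 / (16 ^ 2 * (T * D))) * T = 160 / 256 * D := by field_simp; ring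
      rw [this]; linarith

/-- The parameters of private multiplicative weights: `N` is the size of the private part times
`ε`, and `L`, `D`, `K` are the logarithms of the size of the universe, of `1 / δ` and
of `1 / β`. -/
theorem pmw_parameters {L D lm K N α : ℝ} (hL : 0.69 ≤ L) (hD : 1 / 4 ≤ D) (hlm : 0.69 ≤ lm)
    (hK : 0 ≤ K) (hN : 0 < N)
    (hα : α = 1000 * Real.sqrt (Real.sqrt (L * D) * lm / N) + 8192 * (K / N)) (hα1 : α < 1)
    (T : ℕ) (hT : T = ⌈16 * L / (α / 2) ^ 2⌉₊) :
    0 < α ∧ 1 ≤ T ∧ 16 * L / (α / 2) ^ 2 ≤ T ∧ 4 * (K + 1) ≤ N * α ∧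
      140 * lm ≤ N / (128 * compositionScale T D) * (α / 2) ∧
      32 * K ≤ N / (128 * compositionScale T D) * (α / 2) * T := by
  have hL0 : 0 < L := by linarith
  have hD0 : 0 < D := by linarith
  have hLD : 0.4 ≤ Real.sqrt (L * D) := by
    refine Real.le_sqrt_of_sq_le ?_
    nlinarith
  set B := Real.sqrt (L * D) * lm with hB
  have hB1 : 1 / 4 ≤ B := by rw [hB]; nlinarith
  set A := Real.sqrt (B / N) with hA
  have hA0 : 0 < A := Real.sqrt_pos.2 (by positivity)
  have hA2 : A ^ 2 * N = B := by rw [hA, Real.sq_sqrt (by positivity)]; field_simp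
  have hKN : 0 ≤ K / N := by positivity
  have hα0 : 0 < α := by rw [hα]; positivity
  have hNK : N * (K / N) = K := by field_simp
  have hNα : N * α = 1000 * (N * A) + 8192 * K := by rw [hα]; linear_combination 8192 * hNK
  have hA1 : 1000 * A < 1 := by linarith
  -- as `A` is small, `N * A = B / A` is large; it absorbs the constants that come with `K`
  have hNA : 250 ≤ N * A := by
    by_contra hcon
    push Not at hcon
    have : A ^ 2 * N ≤ A * 250 := by nlinarith
    linarith
  have hceil := Nat.le_ceil (16 * L / (α / 2) ^ 2)
  rw [← hT] at hceil
  have hbig : 1 ≤ 16 * L / (α / 2) ^ 2 := by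
    rw [le_div_iff₀ (by positivity)]; nlinarith
  have hT1 : (1 : ℝ) ≤ T := hbig.trans hceil
  have hTle : (T : ℝ) ≤ 32 * L / (α / 2) ^ 2 := by
    have := Nat.ceil_lt_add_one (by linarith : 0 ≤ 16 * L / (α / 2) ^ 2)
    rw [← hT] at this
    have e : 32 * L / (α / 2) ^ 2 = 2 * (16 * L / (α / 2) ^ 2) := by ring
    linarith
  have hs := compositionScale_pos (by linarith : 0 < (T : ℝ)) hD0
  have hsT := compositionScale_le (by linarith : 0 ≤ (T : ℝ)) D
  have hsα : compositionScale T D * (α / 2) ≤ 6 * Real.sqrt (L * D) := by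
    have h1 : (compositionScale T D) ^ 2 ≤ T * D := by
      rw [compositionScale, Real.sq_sqrt (by positivity)]
      gcongr
      exact min_le_right _ _
    refine le_of_sq_le_sq ?_ (by positivity)
    rw [mul_pow, mul_pow, Real.sq_sqrt (by positivity)]
    calc _ ≤ (T * D) * (α / 2) ^ 2 := by gcongr
      _ ≤ (32 * L / (α / 2) ^ 2 * D) * (α / 2) ^ 2 := by gcongr
      _ = 32 * (L * D) := by field_simp
      _ ≤ 6 ^ 2 * (L * D) := by nlinarith [mul_pos hL0 hD0]
  set s := compositionScale T D with hsdef
  refine ⟨hα0, by exact_mod_cast hT1, hceil, by linarith, ?_, ?_⟩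
  · rw [div_mul_eq_mul_div, le_div_iff₀ (by positivity)]
    have hαA : 500 * A ≤ α / 2 := by rw [hα]; linarith
    have h1 : 140 * lm * (128 * s) * (α / 2) ≤ N * (α / 2) * (α / 2) := by
      calc 140 * lm * (128 * s) * (α / 2) = 17920 * lm * (s * (α / 2)) := by ring
        _ ≤ 17920 * lm * (6 * Real.sqrt (L * D)) := by gcongr
        _ = 107520 * (A ^ 2 * N) := by rw [hA2, hB]; ring
        _ ≤ 250000 * (A ^ 2 * N) := by gcongr; norm_num
        _ = N * (500 * A) * (500 * A) := by ring
        _ ≤ _ := by gcongr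
    exact le_of_mul_le_mul_right h1 (by positivity)
  · rw [div_mul_eq_mul_div, div_mul_eq_mul_div, le_div_iff₀ (by positivity)]
    have h1 : 4096 * K ≤ N * (α / 2) := by linarith [mul_pos hN hA0]
    calc 32 * K * (128 * s) = 4096 * K * s := by ring
      _ ≤ N * (α / 2) * T := by gcongr

/-- For the chosen parameters, the updates run out with probability at most `β / 2`,
where `K = log (1 / β)`. -/
theorem pmwSupermartingale_zero_le {X : Type u} [Fintype X] {κ τ K lm : ℝ} {m T : ℕ}
    (hκ : 0 < κ) (hτ : 0 < τ) (hm : 2 ≤ m) (hlm : lm = Real.log m) (hT : 1 ≤ T)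
    (hTL : 16 * Real.log (Fintype.card X) / τ ^ 2 ≤ T) (h1 : 140 * lm ≤ κ * τ)
    (h2 : 32 * K ≤ κ * τ * T) (c : X → ℝ) :
    pmwSupermartingale κ τ c m T 0 ≤ Real.exp (-(K + Real.log 2)) := by
  have hm0 : (0 : ℝ) < m := by positivity
  have hm2 : (2 : ℝ) ≤ m := by exact_mod_cast hm
  have hT1 : (1 : ℝ) ≤ T := by exact_mod_cast hT
  have hlog2 := Real.log_two_gt_d9
  have hlog2' := Real.log_two_lt_d9
  have hlm2 : Real.log 2 ≤ lm := by
    rw [hlm]; exact Real.log_le_log (by norm_num) hm2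
  -- with this rate, the `2 * (T + m)` tests contribute a factor of at most `exp (T + 1)`
  have hq : falsePositiveRate κ τ ≤ 1 / (2 * m) := by
    have h3 : Real.exp (-(κ * τ / 4)) ≤ 1 / (4 * m) := by
      rw [one_div, Real.exp_neg]
      refine inv_anti₀ (by positivity) ?_
      rw [← Real.log_le_iff_le_exp (by positivity), Real.log_mul (by norm_num) hm0.ne', ← hlm,
        show (4 : ℝ) = 2 ^ 2 by norm_num, Real.log_pow]
      push_cast
      linarith
    calc falsePositiveRate κ τ ≤ 2 * (1 / (4 * m)) := by unfold falsePositiveRate; gcongr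
      _ = _ := by field_simp; norm_num
  have hq0 := falsePositiveRate_pos κ τ
  have hpow : (1 + falsePositiveRate κ τ) ^ (2 * (T + m)) ≤ Real.exp (T + 1) := by
    calc _ ≤ Real.exp (falsePositiveRate κ τ) ^ (2 * (T + m)) := by
          gcongr
          linarith [Real.add_one_le_exp (falsePositiveRate κ τ)]
      _ = Real.exp ((2 * (T + m) : ℕ) * falsePositiveRate κ τ) := by rw [← Real.exp_nat_mul]
      _ ≤ Real.exp (T + 1) := by
          refine Real.exp_le_exp.2 ?_
          push_cast
          calc 2 * ((T : ℝ) + m) * falsePositiveRate κ τ ≤ 2 * ((T : ℝ) + m) * (1 / (2 * m)) := by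
                gcongr
            _ = T / m + 1 := by field_simp
            _ ≤ T + 1 := by
                gcongr
                exact div_le_self (by positivity) (by linarith)
  have hexp : κ / 2 * (2 / τ * Real.log (Fintype.card X) - T * (τ / 4)) ≤ -(κ * τ * T / 16) := by
    have h3 : 2 / τ * Real.log (Fintype.card X) ≤ T * (τ / 8) := by
      rw [div_le_iff₀ (by positivity)] at hTL
      rw [div_mul_eq_mul_div, div_le_iff₀ hτ]
      linarith
    calc _ ≤ κ / 2 * (T * (τ / 8) - T * (τ / 4)) := by gcongr
      _ = _ := by ring
  rw [pmwSupermartingale, mwPotential_zero]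
  calc _ ≤ Real.exp (-(κ * τ * T / 16)) * Real.exp (T + 1) := by gcongr
    _ = Real.exp (-(κ * τ * T / 16) + (T + 1)) := by rw [← Real.exp_add]
    _ ≤ _ := by
        refine Real.exp_le_exp.2 ?_
        have h3 : 96.6 * T ≤ κ * τ * T := by
          gcongr; linarith
        linarith

end parameters

/-! ### Random private blocks and the error bound -/

section rotation

/-- The block of `k` cyclically consecutive entries that ends with the entry `i`. -/
def rotatedBlock (n k : ℕ) [NeZero n] (i : Fin n) : Finset (Fin n) :=
  Finset.univ.filter fun j => ((i - j : Fin n) : ℕ) < k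

theorem card_filter_val_lt {n k : ℕ} (hk : k ≤ n) :
    (Finset.univ.filter fun j : Fin n => (j : ℕ) < k).card = k := by
  have h := Fin.card_filter_val_lt (n := n) (m := k)
  simpa [hk] using h

theorem card_rotatedBlock {n k : ℕ} [NeZero n] (hk : k ≤ n) (i : Fin n) :
    (rotatedBlock n k i).card = k := by
  refine (Finset.card_bij (fun j _ => i - j) ?_ ?_ ?_).trans (card_filter_val_lt hk)
  · intro j hj; simpa [rotatedBlock] using hj
  · intro j _ j' _ h; exact sub_right_injective h
  · intro j hj; exact ⟨i - j, by simpa [rotatedBlock] using hj, by simp⟩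

/-- Each entry lies in the same number of blocks. -/
theorem card_filter_mem_rotatedBlock {n k : ℕ} [NeZero n] (hk : k ≤ n) (j : Fin n) :
    (Finset.univ.filter fun i => j ∈ rotatedBlock n k i).card = k := by
  refine (Finset.card_bij (fun i _ => i - j) ?_ ?_ ?_).trans (card_filter_val_lt hk)
  · intro i hi; simpa [rotatedBlock] using hi
  · intro i _ i' _ h; exact sub_left_injective h
  · intro i hi; exact ⟨i + j, by simpa [rotatedBlock] using hi, by simp⟩

theorem sum_uniform {n : ℕ} [NeZero n] : ∑ _i : Fin n, ((n : ℝ≥0∞))⁻¹ = 1 := by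
  rw [Finset.sum_const, Finset.card_univ, Fintype.card_fin, nsmul_eq_mul]
  exact ENNReal.mul_inv_cancel (by exact_mod_cast NeZero.ne n) (ENNReal.natCast_ne_top n)

theorem sum_rotatedBlock_le {n k : ℕ} [NeZero n] (hk : k ≤ n) {δ δ' : ℝ} (hδ : 0 ≤ δ)
    (h : k * δ + (n - k) ≤ n * δ') (j : Fin n) :
    ∑ i, ((n : ℝ≥0∞))⁻¹ * (if j ∈ rotatedBlock n k i then ENNReal.ofReal δ else 1) ≤
      ENNReal.ofReal δ' := by
  have hn : (0 : ℝ) < n := by exact_mod_cast NeZero.pos n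
  have hkn : (k : ℝ) ≤ n := by exact_mod_cast hk
  have hcompl : (Finset.univ.filter fun i => ¬ j ∈ rotatedBlock n k i).card = n - k := by
    have h1 := Finset.card_filter_add_card_filter_not (s := (Finset.univ : Finset (Fin n)))
      (fun i => j ∈ rotatedBlock n k i)
    rw [card_filter_mem_rotatedBlock hk, Finset.card_univ, Fintype.card_fin] at h1
    omega
  have hsum : ∑ i, (if j ∈ rotatedBlock n k i then ENNReal.ofReal δ else 1) =
      ENNReal.ofReal (k * δ + (n - k)) := by
    rw [Finset.sum_ite, Finset.sum_const, Finset.sum_const, card_filter_mem_rotatedBlock hk, hcompl,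
      ENNReal.ofReal_add (by positivity) (by linarith), ENNReal.ofReal_mul (by positivity),
      ENNReal.ofReal_natCast, ← Nat.cast_sub hk, ENNReal.ofReal_natCast]
    simp
  rw [← Finset.mul_sum, hsum, ← ENNReal.ofReal_natCast n, ← ENNReal.ofReal_inv_of_pos hn,
    ← ENNReal.ofReal_mul (by positivity)]
  refine ENNReal.ofReal_le_ofReal ?_
  rw [inv_mul_le_iff₀ hn]
  exact h

end rotation

section blocks

variable (X : Type u) [Fintype X] [Nonempty X]

theorem divergence_le_one_of_no_shift (v v' l : ℝ) (hl : 0 ≤ l) (h1 : v' ≤ v) (h2 : v ≤ v') :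
    testProb v * (testProb v / testProb v') ^ l * Real.exp (-((1 + l) * 0)) +
      (1 - testProb v) * ((1 - testProb v) / (1 - testProb v')) ^ l ≤ 1 := by
  have := divergence_le_one_of_linear_charge (k := 0) hl le_rfl h1 (by linarith)
  simpa using this

/-- Hiding a random block of size `k` entirely. -/
theorem exists_mechanism_of_hidden_block {n k : ℕ} (hn : 1 ≤ n) (hk1 : 1 ≤ k) (hk : k ≤ n)
    {ε δ δ' α β : ℝ} (hε : 0 < ε) (hδ0 : 0 < δ) (hδ1 : δ < 1) (h : k * δ + (n - k) ≤ n * δ')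
    (hα : (k : ℝ) / n ≤ α) (hβ : 0 ≤ β) (m : ℕ) :
    ∃ M : InteractiveMechanism X n, M.IsDifferentiallyPrivate m ε δ' ∧ M.IsAccurate m α β := by
  have : NeZero n := ⟨by omega⟩
  have hk0 : (0 : ℝ) < k := by exact_mod_cast hk1
  have hθ : 0 < k * (ε / 2) := by positivity
  have hD : 0 < -Real.log δ := by linarith [Real.log_neg hδ0 hδ1]
  refine ⟨pmwMechanism 0 1 0 hθ (rotatedBlock n k) (fun _ => (n : ℝ≥0∞)⁻¹) sum_uniform, ?_, ?_⟩
  · refine pmwMechanism_isDifferentiallyPrivate (Δ := 1 / k) (l := 4 * -Real.log δ / ε) (μ := 0)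
      (δ := δ) le_rfl (by positivity) le_rfl (by positivity) hδ0 hθ (by field_simp; rfl)
      (fun v v' h1 h2 => ?_) ?_ _ _ _ (fun i j _ => ?_) (sum_rotatedBlock_le hk hδ0.le h) m
    · exact divergence_le_one_of_no_shift v v' _ (by positivity) h1 (by simpa using h2)
    · have : 4 * -Real.log δ / ε * (ε / 2) = 2 * -Real.log δ := by field_simp; ring
      rw [this]; simp; linarith
    · rw [card_rotatedBlock hk]
  · refine pmwMechanism_isAccurate 0 1 0 hθ _ _ _ hβ (fun _ => 0) (by simp) fun B S i => ?_
    refine (lintegral_value_inaccurateSet_eq_zero 0 1 hθ _ _ _ B S m i ?_).le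
    rw [card_rotatedBlock hk]; exact hα

/-- Private multiplicative weights on a random block of size `k`. -/
theorem exists_mechanism_of_block (hX : 2 ≤ Fintype.card X) {n k m : ℕ} (hn : 1 ≤ n) (hk1 : 1 ≤ k)
    (hk : k ≤ n) (hm : 2 ≤ m) {ε δ δ' β : ℝ} (hε : 0 < ε) (hε1 : ε < 1) (hδ0 : 0 < δ)
    (hδ1 : δ ≤ 3 / 4) (h : k * δ + (n - k) ≤ n * δ') (hβ : 0 < β) (hβ1 : β < 1) :
    ∃ M : InteractiveMechanism X n, M.IsDifferentiallyPrivate m ε δ' ∧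
      M.IsAccurate m ((k : ℝ) / n * (1000 * Real.sqrt (Real.sqrt
        (Real.log (Fintype.card X) * Real.log (1 / δ)) * Real.log m / (k * ε)) +
          8192 * (Real.log (1 / β) / (k * ε)))) β := by
  have : NeZero n := ⟨by omega⟩
  have hn0 : (0 : ℝ) < n := by exact_mod_cast hn
  have hk0 : (0 : ℝ) < k := by exact_mod_cast hk1
  have hN : 0 < k * ε := by positivity
  have hK : 0 ≤ Real.log (1 / β) := Real.log_nonneg (by rw [le_div_iff₀ hβ]; linarith)
  set α := 1000 * Real.sqrt (Real.sqrt
    (Real.log (Fintype.card X) * Real.log (1 / δ)) * Real.log m / (k * ε)) +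
      8192 * (Real.log (1 / β) / (k * ε)) with hα
  rcases le_or_gt 1 α with hα1 | hα1
  · exact exists_mechanism_of_hidden_block X hn hk1 hk hε hδ0 (by linarith) h
      (le_mul_of_one_le_right (by positivity) hα1) hβ.le m
  have hlog2 := Real.log_two_gt_d9
  have hlog2' := Real.log_two_lt_d9
  have hL : 0.69 ≤ Real.log (Fintype.card X) := by
    have : Real.log 2 ≤ Real.log (Fintype.card X) :=
      Real.log_le_log (by norm_num) (by exact_mod_cast hX)
    linarith
  have hlm : 0.69 ≤ Real.log m := by
    have : Real.log 2 ≤ Real.log m := Real.log_le_log (by norm_num) (by exact_mod_cast hm)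
    linarith
  have hD : 1 / 4 ≤ Real.log (1 / δ) := by
    have h1 := Real.log_le_sub_one_of_pos hδ0
    rw [one_div δ, Real.log_inv]; linarith
  have hDδ : Real.log δ = -Real.log (1 / δ) := by rw [one_div δ, Real.log_inv, neg_neg]
  obtain ⟨hα0, hT1, hTL, hNα, h1, h2⟩ := pmw_parameters hL hD hlm hK hN hα hα1 _ rfl
  set T := ⌈16 * Real.log (Fintype.card X) / (α / 2) ^ 2⌉₊
  set D := Real.log (1 / δ)
  have hT1' : (1 : ℝ) ≤ T := by exact_mod_cast hT1
  obtain ⟨μ, hμ, hdiv, hbudget⟩ := exists_charge hε hε1 hD hT1'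
  have hs := compositionScale_pos (by linarith : (0 : ℝ) < T) (by linarith : 0 < D)
  set s := compositionScale T D
  have hκ : 0 < k * ε / (128 * s) := by positivity
  have hθ : 0 < k * (ε / 2) := by positivity
  have hexp : Real.exp (-(Real.log (1 / β) + Real.log 2)) = β / 2 := by
    rw [neg_add, Real.exp_add, one_div, Real.log_inv, neg_neg, Real.exp_log hβ, Real.exp_neg,
      Real.exp_log (by norm_num)]
    ring
  refine ⟨pmwMechanism (k * ε / (128 * s)) (α / 2) T hθ (rotatedBlock n k)
    (fun _ => (n : ℝ≥0∞)⁻¹) sum_uniform, ?_, ?_⟩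
  · refine pmwMechanism_isDifferentiallyPrivate (Δ := 1 / k) (l := 4 * D / ε) (μ := μ)
      (δ := δ) hκ.le (by positivity) hμ (by positivity) hδ0 hθ (by field_simp; rfl)
      (fun v v' h1 h2 => ?_) (by rw [hDδ]; exact hbudget) _ _ _ (fun i j _ => ?_)
      (sum_rotatedBlock_le hk hδ0.le h) m
    · have hstep : 2 * (k * ε / (128 * s)) * (1 / k) = ε / (64 * s) := by
        field_simp
        norm_num
      exact hdiv v v' h1 (hstep ▸ h2)
    · rw [card_rotatedBlock hk]
  · refine pmwMechanism_isAccurate _ _ T hθ _ _ _ hβ.le (fun _ => ENNReal.ofReal β) ?_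
      fun B S i => ?_
    · rw [← Finset.sum_mul, sum_uniform, one_mul]
    · refine lintegral_value_inaccurateSet_le (Z := α / 2) hκ (by positivity) (by linarith) hθ
        (by positivity) T _ _ _ B S m i ?_ ?_ ?_ fun c => ?_
      · rw [← Finset.card_pos, card_rotatedBlock hk]; exact hk1
      · rw [card_rotatedBlock hk, add_halves]
      · rw [← hexp]
        refine Real.exp_le_exp.2 (neg_le_neg ?_)
        have : k * (ε / 2) * (α / 2) = (k * ε * α) / 4 := by ring
        rw [this]; linarith
      · rw [← hexp]
        exact pmwSupermartingale_zero_le hκ (by positivity) hm rfl hT1 hTL h1 h2 c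

/-- Revealing the dataset with probability `1 - p`, and nothing about it otherwise. -/
theorem exists_mechanism_of_reveal {n : ℕ} (hn : 1 ≤ n) {ε δ α β p : ℝ} (hε : 0 < ε)
    (hp0 : 0 ≤ p) (hp1 : p ≤ 1) (hp : 1 - p / 2 ≤ δ) (hα : 0 ≤ α) (hβ : p ≤ β) (m : ℕ) :
    ∃ M : InteractiveMechanism X n, M.IsDifferentiallyPrivate m ε δ ∧ M.IsAccurate m α β := by
  have hn0 : (0 : ℝ) < n := by exact_mod_cast hn
  have hθ : 0 < n * (ε / 2) := by positivity
  have hq : ∑ i : Bool, (if i then ENNReal.ofReal p else ENNReal.ofReal (1 - p)) = 1 := by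
    simp [ofReal_add_ofReal_one_sub hp0 hp1]
  have hlog : Real.log (1 / 2) < 0 := Real.log_neg (by norm_num) (by norm_num)
  refine ⟨pmwMechanism 0 1 0 hθ (fun i : Bool => if i then Finset.univ else ∅)
    (fun i => if i then ENNReal.ofReal p else ENNReal.ofReal (1 - p)) hq, ?_, ?_⟩
  · refine pmwMechanism_isDifferentiallyPrivate (Δ := 1 / n) (l := 4 * -Real.log (1 / 2) / ε)
      (μ := 0) (δ := 1 / 2) le_rfl (by positivity) le_rfl
      (div_pos (by linarith) hε) (by norm_num) hθ (by field_simp; rfl)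
      (fun v v' h1 h2 => ?_) ?_ _ _ _ (fun i j hj => ?_) (fun j => ?_) m
    · exact divergence_le_one_of_no_shift v v' _ (div_pos (by linarith) hε).le h1
        (by simpa using h2)
    · have : 4 * -Real.log (1 / 2) / ε * (ε / 2) = 2 * -Real.log (1 / 2) := by
        field_simp; ring
      rw [this]; simp only [mul_zero, Nat.cast_zero]; linarith
    · cases i
      · simp at hj
      · simp
    · simp only [Fintype.sum_bool, if_true, Finset.mem_univ, Bool.false_eq_true, if_false,
        Finset.notMem_empty, mul_one]
      rw [← ENNReal.ofReal_mul hp0, ← ENNReal.ofReal_add (by positivity) (by linarith)]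
      exact ENNReal.ofReal_le_ofReal (by linarith)
  · refine pmwMechanism_isAccurate 0 1 0 hθ _ _ hq (hp0.trans hβ)
      (fun i => if i then 1 else 0) ?_ fun B S i => ?_
    · simp only [Fintype.sum_bool, if_true, Bool.false_eq_true, if_false, mul_one, mul_zero,
        add_zero]
      exact ENNReal.ofReal_le_ofReal hβ
    · cases i
      · exact (lintegral_value_inaccurateSet_eq_zero 0 1 hθ _ _ hq B S m false
          (by simpa using hα)).le
      · have := isProbabilityMeasure_expMeasure hθ
        refine (lintegral_mono fun z =>
          InteractiveMechanism.value_indicator_le_one _ B _ _).trans ?_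
        simp

/-- On a universe with one element there is nothing to hide. -/
theorem exists_mechanism_of_subsingleton [Subsingleton X] {n : ℕ} {ε δ α β : ℝ} (hε : 0 < ε)
    (hα : 0 ≤ α) (hβ : 0 ≤ β) (m : ℕ) :
    ∃ M : InteractiveMechanism X n, M.IsDifferentiallyPrivate m ε δ ∧ M.IsAccurate m α β := by
  have hq : ∑ _i : Unit, (1 : ℝ≥0∞) = 1 := by simp
  refine ⟨pmwMechanism 0 1 0 one_pos (fun _ : Unit => ∅) (fun _ => 1) hq, ?_, ?_⟩
  · intro B S S' _ E _
    rw [Subsingleton.elim S S']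
    refine le_trans ?_ (le_add_of_nonneg_right zero_le)
    exact le_mul_of_one_le_left' (ENNReal.one_le_ofReal.2 (Real.one_le_exp hε.le))
  · refine pmwMechanism_isAccurate 0 1 0 one_pos _ _ hq hβ (fun _ => 0) (by simp) fun B S i => ?_
    exact (lintegral_value_inaccurateSet_eq_zero 0 1 one_pos _ _ hq B S m i
      (by simpa using hα)).le

end blocks

section bound

/-- The error of private multiplicative weights on a block of size `k` satisfies the bound of
the theorem. -/
theorem block_error_le {k n ε b b' K : ℝ} (hk : 0 < k) (hn : 0 < n) (hε : 0 < ε)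
    (hb : 0 ≤ b) (hK : 0 < K) (hbb : k / n * b ≤ 4 * b') :
    0 < k / n * (1000 * Real.sqrt (b / (k * ε)) + 8192 * (K / (k * ε))) ∧
    k / n * (1000 * Real.sqrt (b / (k * ε)) + 8192 * (K / (k * ε))) ≤
      4000000 * (b' / (n * ε *
        (k / n * (1000 * Real.sqrt (b / (k * ε)) + 8192 * (K / (k * ε))))) + K / (n * ε)) := by
  set A := Real.sqrt (b / (k * ε)) with hA
  have hA0 : 0 ≤ A := Real.sqrt_nonneg _
  have hA2 : A ^ 2 * (k * ε) = b := by rw [hA, Real.sq_sqrt (by positivity)]; field_simp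
  set J := K / (k * ε) with hJ
  have hJ0 : 0 < J := by positivity
  have hJK : J * (k * ε) = K := by rw [hJ]; field_simp
  set a := 1000 * A + 8192 * J with ha
  have ha0 : 0 < a := by positivity
  refine ⟨by positivity, ?_⟩
  have h1 : a * a ≤ 1000000 * A ^ 2 + 16384 * J * a := by nlinarith [sq_nonneg (a - 1000 * A)]
  have h2 : n * ε * (k / n * a) = k * ε * a := by field_simp
  rw [h2]
  clear_value a
  have h3 : a ≤ 1000000 * A ^ 2 / a + 16384 * J := by
    refine le_of_mul_le_mul_right ?_ ha0
    rw [add_mul, div_mul_cancel₀ _ ha0.ne']; exact h1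
  calc k / n * a ≤ k / n * (1000000 * A ^ 2 / a + 16384 * J) := by gcongr
    _ = 1000000 * ((k / n * b) / (k * ε * a)) + 16384 * (K / (n * ε)) := by
        rw [← hA2, ← hJK]; field_simp
    _ ≤ 1000000 * (4 * b' / (k * ε * a)) + 4000000 * (K / (n * ε)) := by
        gcongr; norm_num
    _ = _ := by ring

end bound

theorem theorem8 :
    ∃ C : ℝ, 0 < C ∧
      ∀ (X : Type u) [Fintype X] [Nonempty X] (n : ℕ), 1 ≤ n →
      ∀ (ε δ : ℝ), 0 < ε → ε < 1 → 0 < δ → δ < 1 →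
      ∀ (m : ℕ) (β : ℝ), (2 : ℝ)⁻¹ ^ m ≤ β → β < 1 →
        ∃ α : ℝ, 0 < α ∧
          α ≤ C * (Real.sqrt (Real.log (Fintype.card X) * Real.log (1 / δ)) * Real.log m /
                (n * ε * α) + Real.log (1 / β) / (n * ε)) ∧
          ∃ M : InteractiveMechanism X n,
            M.IsDifferentiallyPrivate m ε δ ∧ M.IsAccurate m α β := by
  -- the constant is four times the square of the factor `1000` in `exists_mechanism_of_block`
  refine ⟨4000000, by norm_num, ?_⟩
  intro X _ _ n hn ε δ hε hε1 hδ hδ1 m β hβm hβ1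
  have hβ : 0 < β := lt_of_lt_of_le (by positivity) hβm
  have hn0 : (0 : ℝ) < n := by exact_mod_cast hn
  have hK : 0 < Real.log (1 / β) := Real.log_pos (by rw [lt_div_iff₀ hβ]; linarith)
  have hD : 0 < Real.log (1 / δ) := Real.log_pos (by rw [lt_div_iff₀ hδ]; linarith)
  have hlm : 0 ≤ Real.log m := Real.log_natCast_nonneg m
  have hα0 : 0 < Real.log (1 / β) / (n * ε) := by positivity
  -- it is enough to achieve an error of twice the second term
  have hsecond : (∃ M : InteractiveMechanism X n, M.IsDifferentiallyPrivate m ε δ ∧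
      M.IsAccurate m (2 * (Real.log (1 / β) / (n * ε))) β) →
      ∃ α : ℝ, 0 < α ∧
        α ≤ 4000000 * (Real.sqrt (Real.log (Fintype.card X) * Real.log (1 / δ)) * Real.log m /
              (n * ε * α) + Real.log (1 / β) / (n * ε)) ∧
        ∃ M : InteractiveMechanism X n, M.IsDifferentiallyPrivate m ε δ ∧ M.IsAccurate m α β := by
    intro hM
    refine ⟨_, by positivity, ?_, hM⟩
    have : 0 ≤ Real.sqrt (Real.log (Fintype.card X) * Real.log (1 / δ)) * Real.log m /
      (n * ε * (2 * (Real.log (1 / β) / (n * ε)))) := by positivity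
    linarith
  rcases Nat.lt_or_ge m 2 with hm | hm
  · interval_cases m
    -- without queries the hypotheses `1 ≤ β` and `β < 1` are contradictory
    · norm_num at hβm; linarith
    · refine hsecond ⟨laplaceMechanism X n (by positivity : 0 < n * ε),
        laplaceMechanism_isDifferentiallyPrivate _, fun B S => ?_⟩
      refine (laplaceMechanism_isAccurate (by positivity : 0 < n * ε) hβ hβ1 B S).trans
        (measure_mono fun t ht i => (ht i).trans ?_)
      linarith
  rcases Nat.lt_or_ge (Fintype.card X) 2 with hX | hX
  · have : Subsingleton X := Fintype.card_le_one_iff_subsingleton.1 (by omega)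
    exact hsecond (exists_mechanism_of_subsingleton X hε (by positivity) hβ.le m)
  rcases le_or_gt δ (3 / 4) with hδ4 | hδ4
  · -- the whole dataset is private
    have hb := block_error_le hn0 hn0 hε (b := Real.sqrt (Real.log (Fintype.card X) *
      Real.log (1 / δ)) * Real.log m) (b' := Real.sqrt (Real.log (Fintype.card X) *
      Real.log (1 / δ)) * Real.log m) (by positivity) hK (by
        rw [div_self hn0.ne', one_mul]
        exact le_mul_of_one_le_left (by positivity) (by norm_num))
    exact ⟨_, hb.1, hb.2, exists_mechanism_of_block X hX hn hn le_rfl hm hε hε1 hδ hδ4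
      (by linarith) hβ hβ1⟩
  -- for large `δ`, an entry may be public with probability `1 - 2 * (1 - δ)`
  rcases le_or_gt (2 * (1 - δ)) β with hβδ | hβδ
  · exact hsecond (exists_mechanism_of_reveal X hn hε (p := 2 * (1 - δ)) (by linarith)
      (by linarith) (by linarith) (by positivity) hβδ m)
  set k := ⌈2 * (1 - δ) * n⌉₊ with hk
  have hk0 : 0 < 2 * (1 - δ) * n := by
    have : 0 < 1 - δ := by linarith
    positivity
  have hk1 : 1 ≤ k := Nat.one_le_ceil_iff.2 hk0
  have hkn : k ≤ n := Nat.ceil_le.2 (by nlinarith)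
  have hceil : 2 * (1 - δ) * n ≤ k := Nat.le_ceil _
  have hδk : k * (1 / 2 : ℝ) + (n - k) ≤ n * δ := by linarith
  rcases lt_or_ge (2 * (1 - δ) * n) 1 with hsmall | hlarge
  -- the block has a single entry, and hiding it costs an error of only `1 / n`
  · have hk_eq : (k : ℝ) = 1 := by
      have : k ≤ 1 := Nat.ceil_le.2 (by simpa using hsmall.le)
      exact_mod_cast le_antisymm this hk1
    refine hsecond (exists_mechanism_of_hidden_block X hn hk1 hkn hε (by norm_num : (0:ℝ) < 1 / 2)
      (by norm_num) hδk ?_ hβ.le m)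
    have hK2 : 1 / 2 ≤ Real.log (1 / β) := by
      have := Real.log_le_sub_one_of_pos hβ
      rw [one_div β, Real.log_inv]; linarith
    rw [hk_eq, mul_div_assoc', div_le_div_iff₀ hn0 (by positivity)]
    nlinarith
  · have hkle : (k : ℝ) ≤ 4 * (1 - δ) * n := by
      have := Nat.ceil_lt_add_one hk0.le
      rw [← hk] at this; linarith
    have hkr : (0 : ℝ) < k := by exact_mod_cast hk1
    have hkd : (k : ℝ) / n ≤ 4 * (1 - δ) := by rw [div_le_iff₀ hn0]; exact hkle
    have hlogδ : 1 - δ ≤ Real.log (1 / δ) := by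
      have := Real.log_le_sub_one_of_pos hδ
      rw [one_div, Real.log_inv]; linarith
    have hL : 0 ≤ Real.log (Fintype.card X) := Real.log_natCast_nonneg _
    have hsqrt : (1 - δ) * Real.sqrt (Real.log (Fintype.card X) * Real.log (1 / (1 / 2))) ≤
        Real.sqrt (Real.log (Fintype.card X) * Real.log (1 / δ)) := by
      refine Real.le_sqrt_of_sq_le ?_
      have hlog2 : Real.log (1 / (1 / 2)) ≤ 1 := by
        rw [one_div_one_div]; linarith [Real.log_two_lt_d9]
      have hlog2' : 0 ≤ Real.log (1 / (1 / 2)) := Real.log_nonneg (by norm_num)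
      rw [mul_pow, Real.sq_sqrt (by positivity)]
      calc _ ≤ (1 - δ) ^ 2 * (Real.log (Fintype.card X) * 1) := by gcongr
        _ = Real.log (Fintype.card X) * ((1 - δ) * (1 - δ)) := by ring
        _ ≤ Real.log (Fintype.card X) * (1 - δ) := by
            gcongr
            exact mul_le_of_le_one_right (by linarith) (by linarith)
        _ ≤ _ := by gcongr
    have hb := block_error_le hkr hn0 hε (b := Real.sqrt (Real.log (Fintype.card X) *
      Real.log (1 / (1 / 2))) * Real.log m) (b' := Real.sqrt (Real.log (Fintype.card X) *
      Real.log (1 / δ)) * Real.log m) (by positivity) hK (by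
        calc _ ≤ 4 * (1 - δ) * (Real.sqrt (Real.log (Fintype.card X) *
              Real.log (1 / (1 / 2))) * Real.log m) := by gcongr
          _ = 4 * (((1 - δ) * Real.sqrt (Real.log (Fintype.card X) *
              Real.log (1 / (1 / 2)))) * Real.log m) := by ring
          _ ≤ _ := by gcongr)
    exact ⟨_, hb.1, hb.2, exists_mechanism_of_block X hX hn hk1 hkn hm hε hε1 (by norm_num)
      (by norm_num) hδk hβ hβ1⟩
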